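/- Let $S^3\subset\mathbb{C}^2$ be the unit sphere, identified with $\operatorname{SU}(2)$ by sending $(z_1,z_2)$ to the matrix $\begin{pmatrix} z_1 & -\bar z_2\\ z_2 & \bar z_1\end{pmatrix}$, and let $\Gamma$ be a finite subgroup of $\operatorname{SU}(2)$, acting on $S^3\cong\operatorname{SU}(2)$ by left multiplication. Let $$\mathcal{L}=\bar z_1\frac{\partial}{\partial z_2}-\bar z_2\frac{\partial}{\partial z_1},\qquad \overline{\mathcal{L}}=z_1\frac{\partial}{\partial\bar z_2}-z_2\frac{\partial}{\partial\bar z_1},\qquad \mathcal{L}_t=\mathcal{L}+\bar t\,\overline{\mathcal{L}}\quad(t\in\mathbb{C},\ |t|<1).$$ The standard CR structure on $S^3$ is the complex line bundle in $T^{\mathbb{C}}S^3$ spanned by $\mathcal{L}$, and the Rossi CR structure with parameter $t$ is the one spanned by $\mathcal{L}_t$. Then the orbit space $S^3/\Gamma$ is Hausdorff and second countable and is a smooth manifold of dimension $3$ for which the projection $\pi:S^3\to S^3/\Gamma$ is a local diffeomorphism. If $\mathbb{L}$ is the standard CR structure, or the Rossi CR structure for any $t$ with $|t|<1$, then $\mathbb{L}/\Gamma=(d\pi)^{\mathbb{C}}(\mathbb{L})$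 is a well-defined family of subspaces of the fibers of $T^{\mathbb{C}}(S^3/\Gamma)$, and $(S^3/\Gamma,\mathbb{L}/\Gamma)$ is a strongly pseudoconvex abstract CR manifold. Here a pair $(M,\mathbb{L})$ is an abstract CR manifold if $\mathbb{L}$ is a smooth complex subbundle of $T^{\mathbb{C}}M=TM\otimes\mathbb{C}$ that is involutive (the Lie bracket of two local smooth sections of $\mathbb{L}$ is a section of $\mathbb{L}$) and satisfies $\mathbb{L}\cap\overline{\mathbb{L}}=0$; above, $\mathbb{L}/\Gamma$ has rank $1$. It is strongly pseudoconvex if $\mathbb{L}\oplus\overline{\mathbb{L}}$ has complex codimension $1$ in $T^{\mathbb{C}}M$ and at every point $p$ the Levi form $$\mathbb{L}_p\to T_p^{\mathbb{C}}M/(\mathbb{L}_p\oplus\overline{\mathbb{L}}_p),\qquad Z_p\mapsto \tfrac{1}{2i}\,[\overline{Z},Z]_p \bmod \mathbb{L}_p\oplus\overline{\mathbb{L}}_p$$ ($Z$ any local smooth section of $\mathbb{L}$ with value $Z_p$ at $p$) is well defined and definite. -/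

import Mathlib

open scoped Manifold ContDiff TensorProduct ComplexConjugate

noncomputable section

/-! ### Complexified vector spaces -/

section Complexification

variable {V : Type*} [AddCommGroup V] [Module ℝ V]

/-- The real part `ℂ ⊗ V → V`, `c ⊗ v ↦ (re c) v`. -/
def complexRe : ℂ ⊗[ℝ] V →ₗ[ℝ] V :=
  (TensorProduct.lid ℝ V).toLinearMap ∘ₗ LinearMap.rTensor V Complex.reLm

/-- The imaginary part `ℂ ⊗ V → V`, `c ⊗ v ↦ (im c) v`. -/
def complexIm : ℂ ⊗[ℝ] V →ₗ[ℝ] V :=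
  (TensorProduct.lid ℝ V).toLinearMap ∘ₗ LinearMap.rTensor V Complex.imLm

/-- Complex conjugation `ℂ ⊗ V → ℂ ⊗ V`, `c ⊗ v ↦ conj c ⊗ v`. -/
def complexConj : ℂ ⊗[ℝ] V →ₗ[ℝ] ℂ ⊗[ℝ] V :=
  LinearMap.rTensor V Complex.conjAe.toLinearMap

@[simp] theorem complexRe_tmul (c : ℂ) (v : V) : complexRe (c ⊗ₜ[ℝ] v) = c.re • v := by
  simp [complexRe]

@[simp] theorem complexIm_tmul (c : ℂ) (v : V) : complexIm (c ⊗ₜ[ℝ] v) = c.im • v := by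
  simp [complexIm]

@[simp] theorem complexConj_tmul (c : ℂ) (v : V) :
    complexConj (c ⊗ₜ[ℝ] v) = conj c ⊗ₜ[ℝ] v := by
  simp [complexConj]

theorem complexConj_smul (c : ℂ) (x : ℂ ⊗[ℝ] V) :
    complexConj (c • x) = conj c • complexConj x := by
  induction x using TensorProduct.induction_on with
  | zero => simp
  | tmul a v => simp [TensorProduct.smul_tmul']
  | add x y hx hy => simp only [smul_add, map_add, hx, hy]

theorem complexConj_complexConj (x : ℂ ⊗[ℝ] V) : complexConj (complexConj x) = x := by
  induction x using TensorProduct.induction_on with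
  | zero => simp
  | tmul a v => simp
  | add x y hx hy => simp only [map_add, hx, hy]

theorem complexRe_add_I_complexIm (x : ℂ ⊗[ℝ] V) :
    (1 : ℂ) ⊗ₜ[ℝ] complexRe x + Complex.I ⊗ₜ[ℝ] complexIm x = x := by
  induction x using TensorProduct.induction_on with
  | zero => simp
  | tmul a v =>
    rw [complexRe_tmul, complexIm_tmul, TensorProduct.tmul_smul, TensorProduct.tmul_smul,
      TensorProduct.smul_tmul', TensorProduct.smul_tmul', ← TensorProduct.add_tmul]
    congr 1
    apply Complex.ext <;> simp
  | add x y hx hy =>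
    conv_rhs => rw [← hx, ← hy]
    simp only [map_add, TensorProduct.tmul_add]
    abel

/-- The conjugate `{conj v | v ∈ S}` of a complex subspace `S` of `ℂ ⊗ V`. -/
def conjSubmodule (S : Submodule ℂ (ℂ ⊗[ℝ] V)) : Submodule ℂ (ℂ ⊗[ℝ] V) where
  carrier := {x | ∃ v ∈ S, complexConj v = x}
  add_mem' := by
    rintro _ _ ⟨v, hv, rfl⟩ ⟨w, hw, rfl⟩
    exact ⟨v + w, S.add_mem hv hw, map_add _ _ _⟩
  zero_mem' := ⟨0, S.zero_mem, map_zero _⟩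
  smul_mem' := by
    rintro c _ ⟨v, hv, rfl⟩
    exact ⟨conj c • v, S.smul_mem _ hv, by simp [complexConj_smul]⟩

end Complexification

/-! ### Abstract CR manifolds -/

section CR

variable {E : Type*} [NormedAddCommGroup E] [NormedSpace ℝ E]
  {H : Type*} [TopologicalSpace H] (I : ModelWithCorners ℝ E H)
  {M : Type*} [TopologicalSpace M] [ChartedSpace H M]
  {M' : Type*} [TopologicalSpace M'] [ChartedSpace H M']

/-- The complexified tangent space `ℂ ⊗ T_p M`. -/
abbrev CTangentSpace (p : M) : Type _ := ℂ ⊗[ℝ] TangentSpace I p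

/-- The complexification of the differential at `p` of a map `f : M → M'`. -/
def cmfderiv (f : M → M') (p : M) : CTangentSpace I p →ₗ[ℂ] CTangentSpace I (f p) :=
  (mfderiv I I f p).toLinearMap.baseChange ℂ

variable [IsManifold I ∞ M]

/-- A complex vector field is smooth on `U` if its real and imaginary parts are. -/
def CSmoothOn (Z : ∀ p : M, CTangentSpace I p) (U : Set M) : Prop :=
  ContMDiffOn I I.tangent ∞ (fun p ↦ (⟨p, complexRe (Z p)⟩ : TangentBundle I M)) U ∧
  ContMDiffOn I I.tangent ∞ (fun p ↦ (⟨p, complexIm (Z p)⟩ : TangentBundle I M)) U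

/-- The Lie bracket of complex vector fields: the complex bilinear extension of the Lie bracket
of real vector fields. -/
def cLieBracket (Z W : ∀ p : M, CTangentSpace I p) (p : M) : CTangentSpace I p :=
  (1 : ℂ) ⊗ₜ[ℝ]
      (VectorField.mlieBracket I (fun q ↦ complexRe (Z q)) (fun q ↦ complexRe (W q)) p
        - VectorField.mlieBracket I (fun q ↦ complexIm (Z q)) (fun q ↦ complexIm (W q)) p)
    + Complex.I ⊗ₜ[ℝ]
      (VectorField.mlieBracket I (fun q ↦ complexRe (Z q)) (fun q ↦ complexIm (W q)) p
        + VectorField.mlieBracket I (fun q ↦ complexIm (Z q)) (fun q ↦ complexRe (W q)) p)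

/-- `Z` is a smooth section, over the open set `U`, of the family of subspaces `L`. -/
structure IsSmoothSectionOn (L : ∀ p : M, Submodule ℂ (CTangentSpace I p))
    (Z : ∀ p : M, CTangentSpace I p) (U : Set M) : Prop where
  isOpen : IsOpen U
  smooth : CSmoothOn I Z U
  mem : ∀ p ∈ U, Z p ∈ L p

/-- `L` is a smooth complex subbundle of rank `r` of the complexified tangent bundle: every point
has a neighborhood over which `L` has a smooth frame with `r` elements. -/
def IsSmoothSubbundle (L : ∀ p : M, Submodule ℂ (CTangentSpace I p)) (r : ℕ) : Prop :=
  ∀ p : M, ∃ (U : Set M) (Z : Fin r → ∀ q : M, CTangentSpace I q), p ∈ U ∧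
    (∀ i, IsSmoothSectionOn I L (Z i) U) ∧
    ∀ q ∈ U, LinearIndependent ℂ (fun i ↦ Z i q) ∧ Submodule.span ℂ (Set.range fun i ↦ Z i q) = L q

/-- `L` is a CR bundle of rank `r` on `M`, that is, `(M, L)` is an abstract CR manifold:
`L` is a smooth involutive complex subbundle of the complexified tangent bundle
which meets its conjugate only in zero. -/
structure IsCRBundle (L : ∀ p : M, Submodule ℂ (CTangentSpace I p)) (r : ℕ) : Prop where
  subbundle : IsSmoothSubbundle I L r
  inf_conj : ∀ p : M, L p ⊓ conjSubmodule (L p) = ⊥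
  involutive : ∀ (U : Set M) (Z W : ∀ p : M, CTangentSpace I p),
    IsSmoothSectionOn I L Z U → IsSmoothSectionOn I L W U → ∀ p ∈ U, cLieBracket I Z W p ∈ L p

/-- `ℓ` is the Levi form of `L`: for every `v ∈ L_p` and every local smooth section `Z` of `L`
around `p` with `Z_p = v`, the value of `ℓ_p` at `v` is the class of `(1 / 2i) [conj Z, Z]_p`
modulo `L_p + conj L_p`. -/
def IsLeviForm (L : ∀ p : M, Submodule ℂ (CTangentSpace I p))
    (ℓ : ∀ p : M, L p → CTangentSpace I p ⧸ (L p ⊔ conjSubmodule (L p))) : Prop :=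
  ∀ (U : Set M) (Z : ∀ p : M, CTangentSpace I p) (hZ : IsSmoothSectionOn I L Z U)
    (p : M) (hp : p ∈ U),
    ℓ p ⟨Z p, hZ.mem p hp⟩ =
      Submodule.Quotient.mk
        ((1 / (2 * Complex.I)) • cLieBracket I (fun q ↦ complexConj (Z q)) Z p)

/-- `L` is of hypersurface type: `L ⊕ conj L` has complex codimension one in the complexified
tangent bundle. -/
def IsHypersurfaceType (L : ∀ p : M, Submodule ℂ (CTangentSpace I p)) : Prop :=
  ∀ p : M, Module.finrank ℂ (CTangentSpace I p ⧸ (L p ⊔ conjSubmodule (L p))) = 1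

/-- `L` is strongly pseudoconvex: it is of hypersurface type, and its Levi form is well defined and
definite at every point `p`. Definiteness is tested with a real covector `θ` that vanishes on
`L_p + conj L_p`: it is required that `θ (ℓ_p v) > 0` for all `v ≠ 0`. (Changing the sign of `θ`
exchanges positive and negative definite forms.) -/
def IsStronglyPseudoconvex (L : ∀ p : M, Submodule ℂ (CTangentSpace I p)) : Prop :=
  IsHypersurfaceType I L ∧
  ∃ ℓ : ∀ p : M, L p → CTangentSpace I p ⧸ (L p ⊔ conjSubmodule (L p)), IsLeviForm I L ℓ ∧
    ∀ p : M, ∃ θ : (CTangentSpace I p ⧸ (L p ⊔ conjSubmodule (L p))) →ₗ[ℂ] ℂ,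
      (∀ X : TangentSpace I p, (θ (Submodule.Quotient.mk ((1 : ℂ) ⊗ₜ[ℝ] X))).im = 0) ∧
      ∀ v : L p, v ≠ 0 → ∃ r : ℝ, 0 < r ∧ θ (ℓ p v) = r

/-- `L'` is the image bundle `(dπ)^ℂ (L)` of `L` under the map `π : M → M'`
(determined by `L` if `π` is surjective). -/
def IsImageBundle (π : M → M') (L : ∀ p : M, Submodule ℂ (CTangentSpace I p))
    (L' : ∀ p : M', Submodule ℂ (CTangentSpace I p)) : Prop :=
  ∀ p : M, L' (π p) = (L p).map (cmfderiv I π p)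

end CR

/-! ### The sphere and the action of `SU(2)` -/

/-- `ℂ²` with its Euclidean norm. -/
abbrev C2 : Type := EuclideanSpace ℂ (Fin 2)

/-- The unit sphere in `ℂ²`. -/
abbrev S3 : Type := Metric.sphere (0 : C2) 1

/-- The group `SU(2)`. -/
abbrev SU2 : Type := Matrix.specialUnitaryGroup (Fin 2) ℂ

instance finrank_C2_fact : Fact (Module.finrank ℝ C2 = 3 + 1) :=
  ⟨by
    rw [← Module.finrank_mul_finrank ℝ ℂ C2, Complex.finrank_real_complex]
    simp⟩

theorem S3.normSq_add (z : S3) : z.1 0 * (starRingEnd ℂ) (z.1 0) + z.1 1 * (starRingEnd ℂ) (z.1 1) = 1 := by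
  have h : ‖z.1‖ = 1 := by simp
  rw [EuclideanSpace.norm_eq, Real.sqrt_eq_one, Fin.sum_univ_two] at h
  rw [Complex.mul_conj', Complex.mul_conj']
  simpa using congrArg (fun x : ℝ ↦ (x : ℂ)) h

theorem mem_SU2_of_normSq_add {a b : ℂ} (h : a * conj a + b * conj b = 1) :
    !![a, -conj b; b, conj a] ∈ Matrix.specialUnitaryGroup (Fin 2) ℂ := by
  rw [Matrix.mem_specialUnitaryGroup_iff, Matrix.mem_unitaryGroup_iff]
  refine ⟨?_, ?_⟩
  · ext i j
    fin_cases i <;> fin_cases j <;>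
      simp [Matrix.mul_apply, Fin.sum_univ_two, Matrix.star_apply] <;>
      first | ring1 | linear_combination h
  · rw [Matrix.det_fin_two_of]
    linear_combination h

/-- The identification `S³ ≅ SU(2)`, which sends `(z₁, z₂)` to the matrix in `SU(2)` with
first column `(z₁, z₂)`. -/
def sphereEquivSU2 : S3 ≃ SU2 where
  toFun z := ⟨!![z.1 0, -((starRingEnd ℂ) (z.1 1)); z.1 1, (starRingEnd ℂ) (z.1 0)],
    mem_SU2_of_normSq_add (S3.normSq_add z)⟩
  invFun A := ⟨!₂[A.1 0 0, A.1 1 0], by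
    have h := (Matrix.mem_unitaryGroup_iff'.1 (Matrix.mem_specialUnitaryGroup_iff.1 A.2).1)
    have h0 := congrFun (congrFun h 0) 0
    simp only [Matrix.mul_apply, Fin.sum_univ_two, Matrix.star_apply, Matrix.one_apply_eq,
      RCLike.star_def, Complex.conj_mul'] at h0
    rw [mem_sphere_zero_iff_norm, EuclideanSpace.norm_eq, Real.sqrt_eq_one, Fin.sum_univ_two]
    exact_mod_cast h0⟩
  left_inv z := by
    ext i
    fin_cases i <;> simp
  right_inv A := by
    have hA := Matrix.mem_specialUnitaryGroup_iff.1 A.2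
    have h := Matrix.mem_unitaryGroup_iff'.1 hA.1
    have hadj : A.1.adjugate = star A.1 := by
      have h1 : star A.1 * A.1 * A.1.adjugate = A.1.adjugate := by rw [h, one_mul]
      rw [mul_assoc, Matrix.mul_adjugate, hA.2, one_smul, mul_one] at h1
      exact h1.symm
    have h1 := congrFun (congrFun hadj 0) 0
    have h2 := congrFun (congrFun hadj 0) 1
    simp only [Matrix.adjugate_fin_two, Matrix.star_apply, RCLike.star_def] at h1 h2
    simp at h1 h2
    apply Subtype.ext
    ext i j
    fin_cases i <;> fin_cases j <;> simp [h1, ← h2]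

/-- `SU(2)` acts on `S³ ≅ SU(2)` by left multiplication. -/
instance sphereMulAction : MulAction SU2 S3 where
  smul g z := sphereEquivSU2.symm (g * sphereEquivSU2 z)
  one_smul z := by
    change sphereEquivSU2.symm (1 * sphereEquivSU2 z) = z
    simp
  mul_smul g h z := by
    change sphereEquivSU2.symm (g * h * sphereEquivSU2 z) =
      sphereEquivSU2.symm (g * sphereEquivSU2 (sphereEquivSU2.symm (h * sphereEquivSU2 z)))
    simp [mul_assoc]

theorem sphere_smul_def (g : SU2) (z : S3) :
    g • z = sphereEquivSU2.symm (g * sphereEquivSU2 z) := rfl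

/-- In coordinates, the action is the linear action of matrices on column vectors. -/
theorem sphere_smul_coe (g : SU2) (z : S3) :
    (g • z).1 = WithLp.toLp 2 (Matrix.mulVec g.1 (WithLp.ofLp z.1)) := by
  ext i
  fin_cases i <;>
    simp [sphere_smul_def, sphereEquivSU2, Matrix.mul_apply, Matrix.mulVec, dotProduct,
      Fin.sum_univ_two]

instance sphereContinuousConstSMul (Γ : Subgroup SU2) : ContinuousConstSMul Γ S3 where
  continuous_const_smul g := by
    refine Continuous.subtype_mk (f := fun z : S3 ↦ ((g : SU2) • z).1) ?_ _
    simp only [sphere_smul_coe]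
    fun_prop

instance sphereIsCancelSMul (Γ : Subgroup SU2) : IsCancelSMul Γ S3 where
  left_cancel' g z w h := by
    have h' : sphereEquivSU2.symm ((g : SU2) * sphereEquivSU2 z) =
      sphereEquivSU2.symm ((g : SU2) * sphereEquivSU2 w) := h
    simpa using h'
  right_cancel' g g' z h := by
    have h' : sphereEquivSU2.symm ((g : SU2) * sphereEquivSU2 z) =
      sphereEquivSU2.symm ((g' : SU2) * sphereEquivSU2 z) := h
    simpa using h'

/-- The orbit space `S³ / Γ`, with the quotient topology. For finite `Γ` Mathlib makes it a charted
space, the charts being local inverses of the projection composed with charts of the sphere. -/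
abbrev SphereQuotient (Γ : Subgroup SU2) : Type := MulAction.orbitRel.Quotient Γ S3

/-- The projection `S³ → S³ / Γ`. -/
def sphereProj (Γ : Subgroup SU2) : S3 → SphereQuotient Γ := Quotient.mk _

/-! ### The standard and the Rossi CR structures on the sphere -/

/-- `∂/∂z_j = (∂/∂x_j - i ∂/∂y_j) / 2` as a complexified tangent vector of `ℂ²`. -/
def dz (j : Fin 2) : ℂ ⊗[ℝ] C2 :=
  (1 / 2 : ℂ) • ((1 : ℂ) ⊗ₜ[ℝ] EuclideanSpace.single j (1 : ℂ)
    - Complex.I ⊗ₜ[ℝ] EuclideanSpace.single j Complex.I)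

/-- `∂/∂(conj z_j) = (∂/∂x_j + i ∂/∂y_j) / 2` as a complexified tangent vector of `ℂ²`. -/
def dzbar (j : Fin 2) : ℂ ⊗[ℝ] C2 :=
  (1 / 2 : ℂ) • ((1 : ℂ) ⊗ₜ[ℝ] EuclideanSpace.single j (1 : ℂ)
    + Complex.I ⊗ₜ[ℝ] EuclideanSpace.single j Complex.I)

/-- The vector field `ℒ = conj z₁ ∂/∂z₂ - conj z₂ ∂/∂z₁`. -/
def crField (z : C2) : ℂ ⊗[ℝ] C2 :=
  (starRingEnd ℂ) (z 0) • dz 1 - (starRingEnd ℂ) (z 1) • dz 0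

/-- The conjugate vector field `conj ℒ = z₁ ∂/∂(conj z₂) - z₂ ∂/∂(conj z₁)`. -/
def crFieldBar (z : C2) : ℂ ⊗[ℝ] C2 := z 0 • dzbar 1 - z 1 • dzbar 0

/-- The vector field `ℒ_t = ℒ + conj t · conj ℒ`. -/
def rossiField (t : ℂ) (z : C2) : ℂ ⊗[ℝ] C2 := crField z + conj t • crFieldBar z

/-- The complexified differential of the inclusion of `S³` into `ℂ²`. -/
def sphereInclDeriv (z : S3) : CTangentSpace (𝓡 3) z →ₗ[ℂ] ℂ ⊗[ℝ] C2 :=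
  (mvfderiv (𝓡 3) (Subtype.val : S3 → C2) z).toLinearMap.baseChange ℂ

/-- The standard CR bundle of `S³`: the line in the complexified tangent space of the sphere
spanned by `ℒ`. -/
def standardBundle (z : S3) : Submodule ℂ (CTangentSpace (𝓡 3) z) :=
  (Submodule.span ℂ {crField z.1}).comap (sphereInclDeriv z)

/-- The CR bundle of the Rossi sphere: the line in the complexified tangent space of the sphere
spanned by `ℒ_t`. -/
def rossiBundle (t : ℂ) (z : S3) : Submodule ℂ (CTangentSpace (𝓡 3) z) :=
  (Submodule.span ℂ {rossiField t z.1}).comap (sphereInclDeriv z)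

end

noncomputable section

/-! ### Complexified vector spaces: coordinates -/

section Complexification

variable {V : Type*} [AddCommGroup V] [Module ℝ V]

/-! Everything reduces to one global frame. On `S³ ≅ SU(2)` take the real linear fields `Y₀ z = J
z`, `Y₁ z = i J z`, `Y₂ z = i z`, where `J` is right multiplication by the quaternion `j`. They are
tangent to the sphere, independent, invariant under left multiplication (`sphereFlow_smul`), and
satisfy `[Y₀, Y₁] = -2 Y₂` (`mlieBracket_sphereField`). Since `ℒ = (Y₀ - i Y₁) / 2`, the field `ℒ_t`
is a constant combination `a Y₀ + b Y₁` with `Im (conj a * b) = -(1 - |t|²) / 4`, which is nonzero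
for `|t| < 1` (`im_conj_mul_rossi`); the standard structure is the case `t = 0`.

A finite `Γ` acts freely and properly discontinuously by diffeomorphisms, so the quotient is a
manifold and `π` is a local diffeomorphism (`isManifold_quotient`, `isLocalDiffeomorph_quotientMk`).
By invariance the frame descends to a smooth frame with the same bracket, and `dπ` carries the line
of `a Y₀ + b Y₁` upstairs to the line with the same coefficients downstairs.

It remains to treat a line spanned by `F = a Y₀ + b Y₁` on any manifold with a frame such that `[Y₀,
Y₁] = c Y₂`, `c ≠ 0` and `Im (conj a * b) ≠ 0`. Then `F` and `conj F` span the plane of `Y₀, Y₁`,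
involutivity is automatic in rank one, and the Levi form sends `f F` to `|f|² Im (conj a * b) c Y₂`,
which is definite (`isCRBundle_frameLine`, `isStronglyPseudoconvex_frameLine`). -/

theorem complexRe_smul (c : ℂ) (x : ℂ ⊗[ℝ] V) :
    complexRe (c • x) = c.re • complexRe x - c.im • complexIm x := by
  induction x using TensorProduct.induction_on with
  | zero => simp
  | tmul a v => simp [TensorProduct.smul_tmul', sub_smul, mul_smul]
  | add x y hx hy => simp only [smul_add, map_add, hx, hy]; abel

theorem complexIm_smul (c : ℂ) (x : ℂ ⊗[ℝ] V) :
    complexIm (c • x) = c.re • complexIm x + c.im • complexRe x := by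
  induction x using TensorProduct.induction_on with
  | zero => simp
  | tmul a v => simp [TensorProduct.smul_tmul', add_smul, mul_smul]
  | add x y hx hy => simp only [smul_add, map_add, hx, hy]; abel

theorem complex_tensor_ext {x y : ℂ ⊗[ℝ] V} (hre : complexRe x = complexRe y)
    (him : complexIm x = complexIm y) : x = y := by
  rw [← complexRe_add_I_complexIm x, ← complexRe_add_I_complexIm y, hre, him]

theorem conjSubmodule_span_singleton (x : ℂ ⊗[ℝ] V) :
    conjSubmodule (Submodule.span ℂ {x}) = Submodule.span ℂ {complexConj x} := by
  ext y
  constructor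
  · rintro ⟨v, hv, rfl⟩
    obtain ⟨c, rfl⟩ := Submodule.mem_span_singleton.1 hv
    rw [complexConj_smul]
    exact Submodule.smul_mem _ _ (Submodule.mem_span_singleton_self _)
  · intro hy
    obtain ⟨c, rfl⟩ := Submodule.mem_span_singleton.1 hy
    exact ⟨conj c • x, Submodule.smul_mem _ _ (Submodule.mem_span_singleton_self _),
      by simp [complexConj_smul]⟩

/-- The complex linear extension of a real linear functional. -/
def complexCoord (φ : V →ₗ[ℝ] ℝ) : ℂ ⊗[ℝ] V →ₗ[ℂ] ℂ :=
  (TensorProduct.AlgebraTensorModule.rid ℝ ℂ ℂ).toLinearMap ∘ₗ φ.baseChange ℂ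

@[simp] theorem complexCoord_tmul (φ : V →ₗ[ℝ] ℝ) (c : ℂ) (v : V) :
    complexCoord φ (c ⊗ₜ[ℝ] v) = c * φ v := by
  simp [complexCoord, mul_comm]

theorem complexCoord_eq (φ : V →ₗ[ℝ] ℝ) (x : ℂ ⊗[ℝ] V) :
    complexCoord φ x = φ (complexRe x) + φ (complexIm x) * Complex.I := by
  conv_lhs => rw [← complexRe_add_I_complexIm x]
  simp [mul_comm]

theorem sum_complexCoord_tmul {ι : Type*} [Fintype ι] (B : Module.Basis ι ℝ V) (x : ℂ ⊗[ℝ] V) :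
    ∑ i, complexCoord (B.coord i) x ⊗ₜ[ℝ] B i = x := by
  induction x using TensorProduct.induction_on with
  | zero => simp
  | tmul c v =>
    conv_rhs => rw [← B.sum_repr v]
    simp only [complexCoord_tmul, TensorProduct.tmul_sum, Module.Basis.coord_apply,
      TensorProduct.tmul_smul, TensorProduct.smul_tmul']
    refine Finset.sum_congr rfl fun i _ ↦ ?_
    congr 1
    rw [mul_comm, Complex.real_smul]
  | add x y hx hy =>
    simp only [map_add, TensorProduct.add_tmul, Finset.sum_add_distrib, hx, hy]

end Complexification

/-! ### Differentiability of coordinates in a frame -/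

section Frame

variable {E : Type*} [NormedAddCommGroup E] [NormedSpace ℝ E]
  {H : Type*} [TopologicalSpace H] {I : ModelWithCorners ℝ E H}
  {M : Type*} [TopologicalSpace M] [ChartedSpace H M] [IsManifold I ∞ M]

/-- The coordinates of a differentiable vector field in a differentiable frame are
differentiable. -/
theorem mdifferentiableAt_coord {ι : Type} [Fintype ι]
    (B : ∀ q : M, Module.Basis ι ℝ (TangentSpace I q)) {p : M}
    (hB : ∀ i, MDifferentiableAt I I.tangent
      (fun q ↦ (⟨q, B q i⟩ : TangentBundle I M)) p)
    {V : ∀ q : M, TangentSpace I q}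
    (hV : MDifferentiableAt I I.tangent (fun q ↦ (⟨q, V q⟩ : TangentBundle I M)) p) (i : ι) :
    MDifferentiableAt I 𝓘(ℝ, ℝ) (fun q ↦ (B q).coord i (V q)) p := by
  let e := trivializationAt E (TangentSpace I) p
  have hp : p ∈ e.baseSet := FiberBundle.mem_baseSet_trivializationAt' p
  have hu (i : ι) : MDifferentiableAt I 𝓘(ℝ, E)
      (fun q ↦ (e (⟨q, B q i⟩ : TangentBundle I M)).2) p :=
    (e.mdifferentiableAt_section_iff I _ hp).1 (hB i)
  have hv : MDifferentiableAt I 𝓘(ℝ, E) (fun q ↦ (e (⟨q, V q⟩ : TangentBundle I M)).2) p :=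
    (e.mdifferentiableAt_section_iff I _ hp).1 hV
  -- In the trivialization, `T q` sends a coordinate vector to the corresponding combination of the
  -- frame; the coordinates of `V` are therefore obtained by applying the inverse of `T q`.
  let T (q : M) : (ι → ℝ) →L[ℝ] E :=
    ∑ i, (ContinuousLinearMap.smulRightL ℝ (ι → ℝ) E (ContinuousLinearMap.proj i))
      (e (⟨q, B q i⟩ : TangentBundle I M)).2
  have hT : MDifferentiableAt I 𝓘(ℝ, (ι → ℝ) →L[ℝ] E) T p := by
    have hi (i : ι) := (ContinuousLinearMap.smulRightL ℝ (ι → ℝ) E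
      (ContinuousLinearMap.proj i)).differentiableAt.comp_mdifferentiableAt (hu i)
    have h : MDifferentiableAt I 𝓘(ℝ, (ι → ℝ) →L[ℝ] E)
        (∑ i, ((ContinuousLinearMap.smulRightL ℝ (ι → ℝ) E (ContinuousLinearMap.proj i)) ∘
          fun q ↦ (e (⟨q, B q i⟩ : TangentBundle I M)).2)) p :=
      MDifferentiableAt.sum fun i _ ↦ hi i
    refine h.congr_of_eventuallyEq (.of_eq ?_)
    ext1 q
    simp [T]
  have hTq (q : M) (hq : q ∈ e.baseSet) : ∃ Φ : (ι → ℝ) ≃L[ℝ] E, (Φ : (ι → ℝ) →L[ℝ] E) = T q ∧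
      ∀ v : TangentSpace I q, Φ ((B q).equivFun v) = (e (⟨q, v⟩ : TangentBundle I M)).2 := by
    have hlin (v : TangentSpace I q) : (e (⟨q, v⟩ : TangentBundle I M)).2 =
        e.continuousLinearEquivAt ℝ q hq v := rfl
    let Φ₀ : (ι → ℝ) ≃ₗ[ℝ] E :=
      (B q).equivFun.symm.trans (e.continuousLinearEquivAt ℝ q hq).toLinearEquiv
    refine ⟨Φ₀.toContinuousLinearEquiv, ?_, fun v ↦ ?_⟩
    · ext1 c
      have h : Φ₀ c = ∑ i, c i • (e (⟨q, B q i⟩ : TangentBundle I M)).2 := by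
        simp only [hlin, Φ₀, LinearEquiv.trans_apply, Module.Basis.equivFun_symm_apply, map_sum,
          map_smul]
        rfl
      simpa [T] using h
    · rw [hlin]
      simp [Φ₀]
  obtain ⟨Φ, hΦ, -⟩ := hTq p hp
  -- Operator inversion is smooth at an invertible operator, so `q ↦ (T q)⁻¹` is differentiable at
  -- `p`.
  have hinv : MDifferentiableAt I 𝓘(ℝ, E →L[ℝ] (ι → ℝ)) (fun q ↦ (T q).inverse) p := by
    have : DifferentiableAt ℝ ContinuousLinearMap.inverse (T p) := by
      rw [← hΦ]
      exact (contDiffAt_map_inverse (n := 1) Φ).differentiableAt one_ne_zero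
    exact this.comp_mdifferentiableAt hT
  have h := hinv.clm_apply hv
  have h' : MDifferentiableAt I 𝓘(ℝ, ℝ)
      (fun q ↦ (T q).inverse (e (⟨q, V q⟩ : TangentBundle I M)).2 i) p :=
    ((ContinuousLinearMap.proj (R := ℝ) (φ := fun _ : ι ↦ ℝ) i).differentiableAt).comp_mdifferentiableAt h
  refine h'.congr_of_eventuallyEq ?_
  filter_upwards [e.open_baseSet.mem_nhds hp] with q hq
  obtain ⟨Ψ, hΨ, hΨv⟩ := hTq q hq
  rw [← hΨv, ← hΨ, ContinuousLinearMap.inverse_equiv]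
  simp

end Frame

/-! ### The Lie bracket of complex vector fields -/

/-- The real and imaginary parts of a complex vector field are differentiable at `p`. -/
def CMDifferentiableAt {E : Type*} [NormedAddCommGroup E] [NormedSpace ℝ E]
    {H : Type*} [TopologicalSpace H] (I : ModelWithCorners ℝ E H)
    {M : Type*} [TopologicalSpace M] [ChartedSpace H M] [IsManifold I ∞ M]
    (Z : ∀ p : M, CTangentSpace I p) (p : M) : Prop :=
  MDifferentiableAt I I.tangent (fun p ↦ (⟨p, complexRe (Z p)⟩ : TangentBundle I M)) p ∧
  MDifferentiableAt I I.tangent (fun p ↦ (⟨p, complexIm (Z p)⟩ : TangentBundle I M)) p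

section Bracket

variable {E : Type*} [NormedAddCommGroup E] [NormedSpace ℝ E]
  {H : Type*} [TopologicalSpace H] {I : ModelWithCorners ℝ E H}
  {M : Type*} [TopologicalSpace M] [ChartedSpace H M]

theorem complexRe_cLieBracket (Z W : ∀ p : M, CTangentSpace I p) (p : M) :
    complexRe (cLieBracket I Z W p) =
      VectorField.mlieBracket I (fun q ↦ complexRe (Z q)) (fun q ↦ complexRe (W q)) p
        - VectorField.mlieBracket I (fun q ↦ complexIm (Z q)) (fun q ↦ complexIm (W q)) p := by
  simp [cLieBracket]

theorem complexIm_cLieBracket (Z W : ∀ p : M, CTangentSpace I p) (p : M) :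
    complexIm (cLieBracket I Z W p) =
      VectorField.mlieBracket I (fun q ↦ complexRe (Z q)) (fun q ↦ complexIm (W q)) p
        + VectorField.mlieBracket I (fun q ↦ complexIm (Z q)) (fun q ↦ complexRe (W q)) p := by
  simp [cLieBracket]

theorem cLieBracket_swap (Z W : ∀ p : M, CTangentSpace I p) (p : M) :
    cLieBracket I Z W p = -cLieBracket I W Z p := by
  apply complex_tensor_ext
  · rw [map_neg, complexRe_cLieBracket, complexRe_cLieBracket,
      VectorField.mlieBracket_swap_apply (V := fun q ↦ complexRe (Z q)),
      VectorField.mlieBracket_swap_apply (V := fun q ↦ complexIm (Z q))]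
    abel
  · rw [map_neg, complexIm_cLieBracket, complexIm_cLieBracket,
      VectorField.mlieBracket_swap_apply (V := fun q ↦ complexRe (Z q)),
      VectorField.mlieBracket_swap_apply (V := fun q ↦ complexIm (Z q))]
    abel

/-- The bracket at a point depends only on germs. This allows a section of a line bundle, known only
on `U`, to be replaced by its expression in the frame. -/
theorem cLieBracket_congr {Z Z' W W' : ∀ p : M, CTangentSpace I p} {U : Set M} (hU : IsOpen U)
    {p : M} (hp : p ∈ U) (hZ : ∀ q ∈ U, Z q = Z' q) (hW : ∀ q ∈ U, W q = W' q) :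
    cLieBracket I Z W p = cLieBracket I Z' W' p := by
  have key (V V' X X' : ∀ q : M, TangentSpace I q) (hV : ∀ q ∈ U, V q = V' q)
      (hX : ∀ q ∈ U, X q = X' q) :
      VectorField.mlieBracket I V X p = VectorField.mlieBracket I V' X' p := by
    have hn := hU.mem_nhds hp
    refine Filter.EventuallyEq.mlieBracket_vectorField_eq ?_ ?_
    · filter_upwards [hn] with q hq using hV q hq
    · filter_upwards [hn] with q hq using hX q hq
  have h1 (q : M) (hq : q ∈ U) : complexRe (Z q) = complexRe (Z' q) := by rw [hZ q hq]
  have h2 (q : M) (hq : q ∈ U) : complexIm (Z q) = complexIm (Z' q) := by rw [hZ q hq]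
  have h3 (q : M) (hq : q ∈ U) : complexRe (W q) = complexRe (W' q) := by rw [hW q hq]
  have h4 (q : M) (hq : q ∈ U) : complexIm (W q) = complexIm (W' q) := by rw [hW q hq]
  apply complex_tensor_ext
  · rw [complexRe_cLieBracket, complexRe_cLieBracket, key _ _ _ _ h1 h3, key _ _ _ _ h2 h4]
  · rw [complexIm_cLieBracket, complexIm_cLieBracket, key _ _ _ _ h1 h4, key _ _ _ _ h2 h3]

variable [CompleteSpace E] [IsManifold I ∞ M]

/-- The real and imaginary parts of `f • W` are two-term sums of this shape, so this is the real
form of the complex Leibniz rule. -/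
theorem mlieBracket_smul_add_smul_right {V W W' : ∀ p : M, TangentSpace I p} {f g : M → ℝ} {p : M}
    (hW : MDifferentiableAt I I.tangent (fun p ↦ (⟨p, W p⟩ : TangentBundle I M)) p)
    (hW' : MDifferentiableAt I I.tangent (fun p ↦ (⟨p, W' p⟩ : TangentBundle I M)) p)
    (hf : MDifferentiableAt I 𝓘(ℝ, ℝ) f p) (hg : MDifferentiableAt I 𝓘(ℝ, ℝ) g p) :
    VectorField.mlieBracket I V (fun q ↦ f q • W q + g q • W' q) p =
      f p • VectorField.mlieBracket I V W p + g p • VectorField.mlieBracket I V W' p +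
        (mvfderiv I f p (V p) • W p + mvfderiv I g p (V p) • W' p) := by
  have h1 := hf.smul_section hW
  have h2 := hg.smul_section hW'
  have := VectorField.mlieBracket_add_right (V := V) h1 h2
  have e1 := VectorField.mlieBracket_smul_right (V := V) hf hW
  have e2 := VectorField.mlieBracket_smul_right (V := V) hg hW'
  refine this.trans ?_
  refine (congrArg₂ (· + ·) e1 e2).trans ?_
  abel

/-- The Leibniz rule for the Lie bracket of complex vector fields. -/
theorem exists_cLieBracket_smul_right {Z W : ∀ p : M, CTangentSpace I p} {f : M → ℂ} {p : M}
    (hW : CMDifferentiableAt I W p)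
    (hre : MDifferentiableAt I 𝓘(ℝ, ℝ) (fun q ↦ (f q).re) p)
    (him : MDifferentiableAt I 𝓘(ℝ, ℝ) (fun q ↦ (f q).im) p) :
    ∃ k : ℂ, cLieBracket I Z (fun q ↦ f q • W q) p = f p • cLieBracket I Z W p + k • W p := by
  let D (V : TangentSpace I p) : ℂ :=
    ⟨mvfderiv I (fun q ↦ (f q).re) p V, mvfderiv I (fun q ↦ (f q).im) p V⟩
  have hneg : MDifferentiableAt I 𝓘(ℝ, ℝ) (fun q ↦ -(f q).im) p := him.neg
  have hdneg : mvfderiv I (fun q ↦ -(f q).im) p = -mvfderiv I (fun q ↦ (f q).im) p :=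
    mvfderiv_neg
  have eRe (q : M) : complexRe (f q • W q) =
      (f q).re • complexRe (W q) + (-(f q).im) • complexIm (W q) := by
    rw [complexRe_smul, neg_smul, sub_eq_add_neg]
  have eIm (q : M) : complexIm (f q • W q) =
      (f q).re • complexIm (W q) + (f q).im • complexRe (W q) := complexIm_smul _ _
  -- The coefficient is `df (Z p)`, the differential of `f` extended complex linearly.
  refine ⟨D (complexRe (Z p)) + Complex.I * D (complexIm (Z p)), ?_⟩
  apply complex_tensor_ext
  · rw [complexRe_cLieBracket]
    simp only [eRe, eIm, mlieBracket_smul_add_smul_right hW.1 hW.2 hre hneg,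
      mlieBracket_smul_add_smul_right hW.2 hW.1 hre him, map_add, complexRe_smul,
      complexRe_cLieBracket, complexIm_cLieBracket, hdneg]
    simp [D]
    module
  · rw [complexIm_cLieBracket]
    simp only [eRe, eIm, mlieBracket_smul_add_smul_right hW.1 hW.2 hre hneg,
      mlieBracket_smul_add_smul_right hW.2 hW.1 hre him, map_add, complexIm_smul,
      complexRe_cLieBracket, complexIm_cLieBracket, hdneg]
    simp [D]
    module

/-- Modulo the span of `Z` and `W` the bracket is bilinear over functions: the Leibniz rule handles
the second slot, and antisymmetry moves the first slot there. Both involutivity and the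
well-definedness of the Levi form rest on this. -/
theorem exists_cLieBracket_smul_smul {Z W : ∀ p : M, CTangentSpace I p} {f g : M → ℂ} {p : M}
    (hZ : CMDifferentiableAt I Z p) (hW : CMDifferentiableAt I W p)
    (hfre : MDifferentiableAt I 𝓘(ℝ, ℝ) (fun q ↦ (f q).re) p)
    (hfim : MDifferentiableAt I 𝓘(ℝ, ℝ) (fun q ↦ (f q).im) p)
    (hgre : MDifferentiableAt I 𝓘(ℝ, ℝ) (fun q ↦ (g q).re) p)
    (hgim : MDifferentiableAt I 𝓘(ℝ, ℝ) (fun q ↦ (g q).im) p) :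
    ∃ k l : ℂ, cLieBracket I (fun q ↦ f q • Z q) (fun q ↦ g q • W q) p =
      (f p * g p) • cLieBracket I Z W p + k • Z p + l • W p := by
  obtain ⟨l, hl⟩ := exists_cLieBracket_smul_right (Z := fun q ↦ f q • Z q) hW hgre hgim
  obtain ⟨k, hk⟩ := exists_cLieBracket_smul_right (Z := W) hZ hfre hfim
  refine ⟨-(g p * k), l, ?_⟩
  rw [hl, cLieBracket_swap, hk, cLieBracket_swap W Z]
  module

end Bracket

/-! ### Quotients of manifolds by free properly discontinuous smooth actions -/

section QuotientManifold

open MulAction Topology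

variable {E : Type*} [NormedAddCommGroup E] [NormedSpace ℝ E]
  {H : Type*} [TopologicalSpace H] {I : ModelWithCorners ℝ E H}
  {M : Type*} [TopologicalSpace M] {G : Type*} [Group G] [MulAction G M]
  [ContinuousConstSMul G M]

/-- Near every point, a local inverse of the projection `π`, composed with `π`, agrees with the
action of an element of the group. -/
theorem eventuallyEq_smul_of_localSection {s : OpenPartialHomeomorph (orbitRel.Quotient G M) M}
    (hs : (s.symm : M → orbitRel.Quotient G M) = Quotient.mk _) {x : M}
    (hx : (Quotient.mk _ x : orbitRel.Quotient G M) ∈ s.source) :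
    ∃ g : G, (fun y : M ↦ s (Quotient.mk _ y)) =ᶠ[𝓝 x] fun y ↦ g • y := by
  have hmk : ∀ q ∈ s.source, (Quotient.mk _ (s q) : orbitRel.Quotient G M) = q := fun q hq ↦ by
    rw [← hs]; exact s.left_inv hq
  -- The points `x` and `s (π x)` lie in one orbit. The element `g` relating them still works
  -- nearby, because `g • y` stays in the target of `s`, where `s` inverts `π`, and `π (g • y) = π
  -- y`.
  obtain ⟨g, hg⟩ : ∃ g : G, g • x = s (Quotient.mk _ x) := by
    have h : (orbitRel G M) (s (Quotient.mk _ x)) x := Quotient.exact (hmk _ hx)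
    exact (orbitRel_apply.1 h)
  refine ⟨g, ?_⟩
  have hcont : ContinuousAt (fun y : M ↦ g • y) x := (continuous_const_smul g).continuousAt
  have htgt : s.target ∈ 𝓝 (g • x) := by
    rw [hg]; exact s.open_target.mem_nhds (s.map_source hx)
  filter_upwards [hcont htgt] with y hy
  have h : (Quotient.mk _ (g • y) : orbitRel.Quotient G M) = Quotient.mk _ y :=
    Quotient.sound (orbitRel_apply.2 ⟨g, rfl⟩)
  rw [← h, ← hs]
  exact s.right_inv hy

variable [ChartedSpace H M]

/-- Locally the composite is the action of a single group element. All smoothness statements about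
the quotient reduce to this one. -/
theorem contMDiffAt_localSection_comp (hG : ∀ g : G, ContMDiff I I ∞ (fun x : M ↦ g • x))
    {s : OpenPartialHomeomorph (orbitRel.Quotient G M) M}
    (hs : (s.symm : M → orbitRel.Quotient G M) = Quotient.mk _) {x : M}
    (hx : (Quotient.mk _ x : orbitRel.Quotient G M) ∈ s.source) :
    ContMDiffAt I I ∞ (fun y : M ↦ s (Quotient.mk _ y)) x := by
  obtain ⟨g, hg⟩ := eventuallyEq_smul_of_localSection hs hx
  exact (hG g).contMDiffAt.congr_of_eventuallyEq hg

variable [ProperlyDiscontinuousSMul G M] [IsCancelSMul G M] [T2Space M] [LocallyCompactSpace M]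

theorem isLocalHomeomorph_quotientMk :
    IsLocalHomeomorph (Quotient.mk _ : M → orbitRel.Quotient G M) :=
  isQuotientCoveringMap_quotientMk_of_properlyDiscontinuousSMul.isCoveringMap.isLocalHomeomorph

/-- This unfolds the atlas of the quotient; afterwards its charts enter only as a local inverse of
the projection followed by a chart of `M`. -/
theorem exists_localSection_of_mem_atlas {c : OpenPartialHomeomorph (orbitRel.Quotient G M) H}
    (hc : c ∈ atlas H (orbitRel.Quotient G M)) :
    ∃ (s : OpenPartialHomeomorph (orbitRel.Quotient G M) M) (x : M),
      (s.symm : M → orbitRel.Quotient G M) = Quotient.mk _ ∧ c = s.trans (chartAt H x) := by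
  obtain ⟨q, rfl⟩ := hc
  exact ⟨_, _, by simp, rfl⟩

theorem isManifold_quotient [IsManifold I ∞ M] (hG : ∀ g : G, ContMDiff I I ∞ (fun x : M ↦ g • x)) :
    IsManifold I ∞ (orbitRel.Quotient G M) := by
  refine isManifold_of_contDiffOn I ∞ _ fun c c' hc hc' ↦ ?_
  obtain ⟨s, x, hs, rfl⟩ := exists_localSection_of_mem_atlas hc
  obtain ⟨s', x', hs', rfl⟩ := exists_localSection_of_mem_atlas hc'
  rw [← contMDiffOn_iff_contDiffOn]
  -- A transition map is a chart of `M` after `s' ∘ π` after an inverse chart of `M`, and the middle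
  -- factor is locally a group element.
  have key : ContMDiffOn I I ∞ ((s.trans (chartAt H x)).symm.trans (s'.trans (chartAt H x')))
      ((s.trans (chartAt H x)).symm.trans (s'.trans (chartAt H x'))).source := by
    intro y hy
    simp only [mfld_simps, hs] at hy
    have h1 : ContMDiffAt I I ∞ (chartAt H x).symm y :=
      contMDiffOn_chart_symm.contMDiffAt ((chartAt H x).open_target.mem_nhds hy.1.1)
    have h2 := contMDiffAt_localSection_comp hG hs' hy.2.1
    have h3 : ContMDiffAt I I ∞ (chartAt H x') (s' (Quotient.mk _ ((chartAt H x).symm y))) :=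
      contMDiffOn_chart.contMDiffAt ((chartAt H x').open_source.mem_nhds hy.2.2)
    have h4 := h3.comp y (h2.comp y h1)
    refine ContMDiffAt.contMDiffWithinAt (h4.congr_of_eventuallyEq (.of_eq ?_))
    ext1 z
    simp only [mfld_simps, hs]
  refine I.contMDiff.comp_contMDiffOn (key.comp (I.contMDiffOn_symm.mono ?_) ?_)
  · exact Set.inter_subset_right
  · exact fun y hy ↦ hy.1

/-- Read in a chart of the target, the projection becomes a chart of `M` composed with `s ∘ π`. -/
theorem contMDiff_quotientMk [IsManifold I ∞ M] (hG : ∀ g : G, ContMDiff I I ∞ (fun x : M ↦ g • x)) :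
    ContMDiff I I ∞ (Quotient.mk _ : M → orbitRel.Quotient G M) := by
  intro p
  rw [contMDiffAt_iff_target]
  refine ⟨(isLocalHomeomorph_quotientMk (G := G) (M := M)).continuous.continuousAt, ?_⟩
  obtain ⟨s, x, hs, hc⟩ := exists_localSection_of_mem_atlas
    (chart_mem_atlas H (Quotient.mk _ p : orbitRel.Quotient G M))
  have hp := mem_chart_source H (Quotient.mk _ p : orbitRel.Quotient G M)
  rw [hc] at hp
  simp only [mfld_simps] at hp
  have h2 := contMDiffAt_localSection_comp hG hs hp.1
  have h3 : ContMDiffAt I I ∞ (chartAt H x) (s (Quotient.mk _ p)) :=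
    contMDiffOn_chart.contMDiffAt ((chartAt H x).open_source.mem_nhds hp.2)
  refine (I.contMDiff.contMDiffAt.comp p (h3.comp p h2)).congr_of_eventuallyEq (.of_eq ?_)
  ext1 z
  simp only [extChartAt, hc, mfld_simps]

/-- A local inverse of the projection to the quotient is smooth. -/
theorem contMDiffOn_localSection [IsManifold I ∞ M] (hG : ∀ g : G, ContMDiff I I ∞ (fun x : M ↦ g • x))
    {s : OpenPartialHomeomorph (orbitRel.Quotient G M) M}
    (hs : (s.symm : M → orbitRel.Quotient G M) = Quotient.mk _) :
    ContMDiffOn I I ∞ s s.source := by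
  have := isManifold_quotient (M := M) (I := I) hG
  intro q hq
  obtain ⟨s', x, hs', hc⟩ := exists_localSection_of_mem_atlas (chart_mem_atlas H q)
  have hqc := mem_chart_source H q
  rw [hc] at hqc
  simp only [mfld_simps] at hqc
  have hq' : (Quotient.mk _ (s' q) : orbitRel.Quotient G M) = q := by
    rw [← hs']; exact s'.left_inv hqc.1
  have h0 : ContMDiffAt I I ∞ (chartAt H q) q :=
    contMDiffOn_chart.contMDiffAt ((chartAt H q).open_source.mem_nhds (mem_chart_source H q))
  have e0 : chartAt H q q = chartAt H x (s' q) := by rw [hc]; rfl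
  have h1 : ContMDiffAt I I ∞ (chartAt H x).symm (chartAt H q q) := by
    rw [e0]
    exact contMDiffOn_chart_symm.contMDiffAt
      ((chartAt H x).open_target.mem_nhds ((chartAt H x).map_source hqc.2))
  have e1 : (chartAt H x).symm (chartAt H q q) = s' q := by
    rw [e0, (chartAt H x).left_inv hqc.2]
  -- Near `q` one has `s = (s ∘ π) ∘ (chartAt H x)⁻¹ ∘ chartAt H q`, because the chart at `q` is
  -- `s'` followed by `chartAt H x` and `π` inverts `s'`.
  have h2 : ContMDiffAt I I ∞ (fun y : M ↦ s (Quotient.mk _ y))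
      ((chartAt H x).symm (chartAt H q q)) :=
    contMDiffAt_localSection_comp hG hs (by rwa [e1, hq'])
  refine ContMDiffAt.contMDiffWithinAt
    ((h2.comp q (h1.comp q h0)).congr_of_eventuallyEq ?_)
  filter_upwards [(chartAt H q).open_source.mem_nhds (mem_chart_source H q)] with r hr
  rw [hc] at hr
  simp only [mfld_simps] at hr
  have hr' : (Quotient.mk _ (s' r) : orbitRel.Quotient G M) = r := by
    rw [← hs']; exact s'.left_inv hr.1
  simp only [hc, mfld_simps, (chartAt H x).left_inv hr.2, hr']

theorem isLocalDiffeomorph_quotientMk [IsManifold I ∞ M] (hG : ∀ g : G, ContMDiff I I ∞ (fun x : M ↦ g • x)) :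
    IsLocalDiffeomorph I I ∞ (Quotient.mk _ : M → orbitRel.Quotient G M) := by
  intro p
  obtain ⟨e, hp, he⟩ := isLocalHomeomorph_quotientMk (G := G) (M := M) p
  refine ⟨⟨e.toPartialEquiv, e.open_source, e.open_target, ?_, ?_⟩, hp, ?_⟩
  · exact (contMDiff_quotientMk hG).contMDiffOn.congr fun y _ ↦ (congrFun he y).symm
  · exact contMDiffOn_localSection hG (s := e.symm) he.symm
  · exact fun y _ ↦ congrFun he y

end QuotientManifold

/-! ### CR structures spanned by constant combinations of the fields of a frame -/

section FrameCR

variable {E : Type*} [NormedAddCommGroup E] [NormedSpace ℝ E]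
  {H : Type*} [TopologicalSpace H] {I : ModelWithCorners ℝ E H}
  {M : Type*} [TopologicalSpace M] [ChartedSpace H M]
  (B : ∀ q : M, Module.Basis (Fin 3) ℝ (TangentSpace I q))

/-- The complex vector field `a Y₀ + b Y₁`, for a frame `Y₀, Y₁, Y₂`. -/
def frameField (a b : ℂ) (q : M) : CTangentSpace I q := a ⊗ₜ[ℝ] B q 0 + b ⊗ₜ[ℝ] B q 1

/-- The complex line spanned by `a Y₀ + b Y₁`, for a frame `Y₀, Y₁, Y₂`. -/
def frameLine (a b : ℂ) (q : M) : Submodule ℂ (CTangentSpace I q) :=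
  Submodule.span ℂ {frameField B a b q}

theorem frameField_mem (a b : ℂ) (q : M) : frameField B a b q ∈ frameLine B a b q :=
  Submodule.mem_span_singleton_self _

theorem complexRe_frameField (a b : ℂ) (q : M) :
    complexRe (frameField B a b q) = a.re • B q 0 + b.re • B q 1 := by
  simp [frameField]

theorem complexIm_frameField (a b : ℂ) (q : M) :
    complexIm (frameField B a b q) = a.im • B q 0 + b.im • B q 1 := by
  simp [frameField]

theorem complexConj_frameField (a b : ℂ) (q : M) :
    complexConj (frameField B a b q) = frameField B (conj a) (conj b) q := by
  simp [frameField]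

theorem conjSubmodule_frameLine (a b : ℂ) (q : M) :
    conjSubmodule (frameLine B a b q) = frameLine B (conj a) (conj b) q := by
  rw [frameLine, conjSubmodule_span_singleton, complexConj_frameField, frameLine]

theorem complexCoord_frameField_zero (a b : ℂ) (q : M) :
    complexCoord ((B q).coord 0) (frameField B a b q) = a := by
  simp [frameField]

theorem complexCoord_frameField_one (a b : ℂ) (q : M) :
    complexCoord ((B q).coord 1) (frameField B a b q) = b := by
  simp [frameField]

theorem complexCoord_frameField_two (a b : ℂ) (q : M) :
    complexCoord ((B q).coord 2) (frameField B a b q) = 0 := by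
  simp [frameField]

/-- The coefficient of a section of the line spanned by `a Y₀ + b Y₁`. -/
def frameCoeff (a : ℂ) (Z : ∀ q : M, CTangentSpace I q) (q : M) : ℂ :=
  complexCoord ((B q).coord 0) (Z q) / a

theorem frameCoeff_smul_frameField {a b : ℂ} (ha : a ≠ 0) {Z : ∀ q : M, CTangentSpace I q} {q : M}
    (h : Z q ∈ frameLine B a b q) : frameCoeff B a Z q • frameField B a b q = Z q := by
  obtain ⟨c, hc⟩ := Submodule.mem_span_singleton.1 h
  rw [frameCoeff, ← hc, map_smul, complexCoord_frameField_zero, smul_eq_mul,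
    mul_div_cancel_right₀ _ ha]

/-- The difference equals `2i Im (conj a * b)`. It is the determinant of the coordinates of `conj F`
and `F` for `F = a Y₀ + b Y₁`, so the hypothesis on the imaginary part says that these two fields
are independent. -/
theorem det_ne_zero_of_im_ne_zero {a b : ℂ} (h : (conj a * b).im ≠ 0) :
    conj a * b - conj b * a ≠ 0 := by
  intro h0
  apply h
  have := congrArg Complex.im h0
  simp at this ⊢
  linarith

theorem frameLine_inf_conj {a b : ℂ} (h : (conj a * b).im ≠ 0) (q : M) :
    frameLine B a b q ⊓ conjSubmodule (frameLine B a b q) = ⊥ := by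
  rw [conjSubmodule_frameLine, eq_bot_iff]
  rintro x ⟨h1, h2⟩
  obtain ⟨c, rfl⟩ := Submodule.mem_span_singleton.1 h1
  obtain ⟨d, hd⟩ := Submodule.mem_span_singleton.1 h2
  have e0 := congrArg (complexCoord ((B q).coord 0)) hd
  have e1 := congrArg (complexCoord ((B q).coord 1)) hd
  simp only [map_smul, complexCoord_frameField_zero, complexCoord_frameField_one,
    smul_eq_mul] at e0 e1
  -- Elimination of `d` from the two coordinate equations.
  have hc : c * (conj a * b - conj b * a) = 0 := by
    linear_combination conj b * e0 - conj a * e1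
  have := (mul_eq_zero.1 hc).resolve_right (det_ne_zero_of_im_ne_zero h)
  simp [this]

/-- Two independent vectors in the complex plane spanned by `Y₀` and `Y₁` span it, and this plane is
where the third coordinate vanishes. -/
theorem frameLine_sup_conj {a b : ℂ} (h : (conj a * b).im ≠ 0) (q : M) :
    frameLine B a b q ⊔ conjSubmodule (frameLine B a b q) =
      LinearMap.ker (complexCoord ((B q).coord 2)) := by
  rw [conjSubmodule_frameLine]
  have hd := det_ne_zero_of_im_ne_zero h
  apply le_antisymm
  · refine sup_le ?_ ?_ <;>
    · rw [frameLine, Submodule.span_singleton_le_iff_mem, LinearMap.mem_ker,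
        complexCoord_frameField_two]
  · intro x hx
    rw [LinearMap.mem_ker] at hx
    have hsum := sum_complexCoord_tmul (B q) x
    rw [Fin.sum_univ_three, hx, TensorProduct.zero_tmul, add_zero] at hsum
    set u := complexCoord ((B q).coord 0) x
    set v := complexCoord ((B q).coord 1) x
    obtain ⟨k, l, e0, e1⟩ : ∃ k l : ℂ, u = k * a + l * conj a ∧ v = k * b + l * conj b := by
      -- Cramer's rule.
      refine ⟨(conj a * v - conj b * u) / (conj a * b - conj b * a),
        (b * u - a * v) / (conj a * b - conj b * a), ?_, ?_⟩ <;>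
      · field_simp
        ring
    have key : x = k • frameField B a b q + l • frameField B (conj a) (conj b) q := by
      rw [← hsum, e0, e1]
      simp only [frameField, smul_add, TensorProduct.smul_tmul', smul_eq_mul,
        TensorProduct.add_tmul]
      abel
    rw [key]
    exact Submodule.add_mem_sup (Submodule.smul_mem _ _ (frameField_mem B _ _ q))
      (Submodule.smul_mem _ _ (frameField_mem B _ _ q))

theorem complexCoord_coord_surjective (q : M) (i : Fin 3) :
    Function.Surjective (complexCoord ((B q).coord i)) := fun c ↦ ⟨c ⊗ₜ B q i, by simp⟩

variable {B}

theorem isHypersurfaceType_frameLine {a b : ℂ} (h : (conj a * b).im ≠ 0) :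
    IsHypersurfaceType I (frameLine B a b) := by
  intro q
  rw [frameLine_sup_conj B h]
  rw [((complexCoord ((B q).coord 2)).quotKerEquivOfSurjective
    (complexCoord_coord_surjective B q 2)).finrank_eq, Module.finrank_self]

variable [IsManifold I ∞ M]
  (hB : ∀ i, ContMDiff I I.tangent ∞ (fun q ↦ (⟨q, B q i⟩ : TangentBundle I M)))

include hB in
theorem cSmoothOn_frameField (a b : ℂ) (U : Set M) : CSmoothOn I (frameField B a b) U := by
  have key (s t : ℝ) : ContMDiffOn I I.tangent ∞
      (fun q ↦ (⟨q, s • B q 0 + t • B q 1⟩ : TangentBundle I M)) U :=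
    ((((hB 0).const_smul_section (a := s)).add_section
      ((hB 1).const_smul_section (a := t))).contMDiffOn)
  constructor
  · simpa only [complexRe_frameField] using key a.re b.re
  · simpa only [complexIm_frameField] using key a.im b.im

include hB in
theorem isSmoothSubbundle_frameLine {a b : ℂ} (h : (conj a * b).im ≠ 0) :
    IsSmoothSubbundle I (frameLine B a b) 1 := by
  intro p
  refine ⟨Set.univ, fun _ ↦ frameField B a b, trivial, fun _ ↦ ⟨isOpen_univ, ?_, ?_⟩, ?_⟩
  · exact cSmoothOn_frameField hB a b _
  · exact fun q _ ↦ frameField_mem B a b q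
  · intro q _
    refine ⟨?_, by rw [Set.range_const, frameLine]⟩
    rw [linearIndependent_unique_iff]
    intro h0
    have := congrArg (complexCoord ((B q).coord 0)) h0
    rw [complexCoord_frameField_zero, map_zero] at this
    simp [this] at h

theorem CSmoothOn.cMDifferentiableAt {Z : ∀ q : M, CTangentSpace I q} {U : Set M}
    (hZ : CSmoothOn I Z U) (hU : IsOpen U) {p : M} (hp : p ∈ U) : CMDifferentiableAt I Z p :=
  ⟨(hZ.1.contMDiffAt (hU.mem_nhds hp)).mdifferentiableAt (by simp),
    (hZ.2.contMDiffAt (hU.mem_nhds hp)).mdifferentiableAt (by simp)⟩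

include hB in
theorem cMDifferentiableAt_frameField (a b : ℂ) (p : M) :
    CMDifferentiableAt I (frameField B a b) p :=
  (cSmoothOn_frameField hB a b Set.univ).cMDifferentiableAt isOpen_univ trivial

include hB in
theorem mdifferentiableAt_frameCoeff (a : ℂ) {Z : ∀ q : M, CTangentSpace I q} {p : M}
    (hZ : CMDifferentiableAt I Z p) :
    MDifferentiableAt I 𝓘(ℝ, ℝ) (fun q ↦ (frameCoeff B a Z q).re) p ∧
    MDifferentiableAt I 𝓘(ℝ, ℝ) (fun q ↦ (frameCoeff B a Z q).im) p := by
  have hB' (i) := (hB i).mdifferentiableAt (x := p) (by simp)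
  have hre := mdifferentiableAt_coord B hB' hZ.1 0
  have him := mdifferentiableAt_coord B hB' hZ.2 0
  have key (s t : ℝ) := ((hre.const_smul s).add (him.const_smul t))
  constructor
  · refine (key (a⁻¹).re (-(a⁻¹).im)).congr_of_eventuallyEq (.of_eq ?_)
    ext1 q
    simp [frameCoeff, complexCoord_eq, div_eq_mul_inv, -Complex.inv_re, -Complex.inv_im]
    ring
  · refine (key (a⁻¹).im (a⁻¹).re).congr_of_eventuallyEq (.of_eq ?_)
    ext1 q
    simp [frameCoeff, complexCoord_eq, div_eq_mul_inv, -Complex.inv_re, -Complex.inv_im]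
    ring

variable [CompleteSpace E]

include hB in
-- For constant coefficients the bracket is bilinear and alternating in the combinations of `Y₀,
-- Y₁`, hence a determinant times `[Y₀, Y₁]`.
theorem cLieBracket_frameField (a b a' b' : ℂ) (p : M) :
    cLieBracket I (frameField B a b) (frameField B a' b') p =
      (a * b' - b * a') ⊗ₜ[ℝ]
        VectorField.mlieBracket I (fun q ↦ B q 0) (fun q ↦ B q 1) p := by
  have h0 := (hB 0).mdifferentiableAt (x := p) (by simp)
  have h1 := (hB 1).mdifferentiableAt (x := p) (by simp)
  have hconst (V : ∀ q : M, TangentSpace I q) (s t : ℝ) :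
      VectorField.mlieBracket I V (fun q ↦ s • B q 0 + t • B q 1) p =
        s • VectorField.mlieBracket I V (fun q ↦ B q 0) p +
          t • VectorField.mlieBracket I V (fun q ↦ B q 1) p := by
    have := mlieBracket_smul_add_smul_right (V := V) h0 h1
      (mdifferentiableAt_const (c := s)) (mdifferentiableAt_const (c := t))
    simpa [mvfderiv_const] using this
  have key (s t s' t' : ℝ) :
      VectorField.mlieBracket I (fun q ↦ s • B q 0 + t • B q 1)
        (fun q ↦ s' • B q 0 + t' • B q 1) p =
        (s * t' - t * s') • VectorField.mlieBracket I (fun q ↦ B q 0) (fun q ↦ B q 1) p := by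
    have hconst' (V : ∀ q : M, TangentSpace I q) :
        VectorField.mlieBracket I (fun q ↦ s • B q 0 + t • B q 1) V p =
          s • VectorField.mlieBracket I (fun q ↦ B q 0) V p +
            t • VectorField.mlieBracket I (fun q ↦ B q 1) V p := by
      rw [VectorField.mlieBracket_swap_apply, hconst,
        VectorField.mlieBracket_swap_apply (V := fun q ↦ B q 0),
        VectorField.mlieBracket_swap_apply (V := fun q ↦ B q 1)]
      module
    rw [hconst, hconst', hconst',
      VectorField.mlieBracket_swap_apply (V := fun q ↦ B q 1) (W := fun q ↦ B q 0)]
    simp only [VectorField.mlieBracket_self, Pi.zero_apply]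
    module
  apply complex_tensor_ext
  · rw [complexRe_cLieBracket]
    simp only [complexRe_frameField, complexIm_frameField, key, complexRe_tmul]
    rw [← sub_smul]
    congr 1
    simp
    ring
  · rw [complexIm_cLieBracket]
    simp only [complexRe_frameField, complexIm_frameField, key, complexIm_tmul]
    rw [← add_smul]
    congr 1
    simp
    ring

theorem im_ne_zero_left {a b : ℂ} (h : (conj a * b).im ≠ 0) : a ≠ 0 := by
  rintro rfl
  simp at h

include hB in
-- Involutivity is automatic in rank one: two sections are `f F` and `g F`, and their bracket is `f
-- g [F, F] = 0` plus multiples of `F`.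
theorem isCRBundle_frameLine {a b : ℂ} (h : (conj a * b).im ≠ 0) :
    IsCRBundle I (frameLine B a b) 1 where
  subbundle := isSmoothSubbundle_frameLine hB h
  inf_conj := frameLine_inf_conj B h
  involutive U Z W hZ hW p hp := by
    have ha := im_ne_zero_left h
    have hdZ := mdifferentiableAt_frameCoeff hB a (hZ.smooth.cMDifferentiableAt hZ.isOpen hp)
    have hdW := mdifferentiableAt_frameCoeff hB a (hW.smooth.cMDifferentiableAt hW.isOpen hp)
    have hF := cMDifferentiableAt_frameField hB a b p
    obtain ⟨k, l, hkl⟩ := exists_cLieBracket_smul_smul hF hF hdZ.1 hdZ.2 hdW.1 hdW.2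
    rw [cLieBracket_congr hZ.isOpen hp
      (fun q hq ↦ (frameCoeff_smul_frameField B ha (hZ.mem q hq)).symm)
      (fun q hq ↦ (frameCoeff_smul_frameField B ha (hW.mem q hq)).symm), hkl,
      cLieBracket_frameField hB, mul_comm b a, sub_self, TensorProduct.zero_tmul, smul_zero,
      zero_add]
    exact Submodule.add_mem _ (Submodule.smul_mem _ _ (frameField_mem B a b p))
      (Submodule.smul_mem _ _ (frameField_mem B a b p))

variable (B) in
/-- The Levi form of the line spanned by `a Y₀ + b Y₁`, if `[Y₀, Y₁] = c Y₂`. -/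
def frameLeviForm (a b : ℂ) (c : ℝ) (p : M) (v : frameLine B a b p) :
    CTangentSpace I p ⧸ (frameLine B a b p ⊔ conjSubmodule (frameLine B a b p)) :=
  Submodule.Quotient.mk
    ((((conj a * b).im * c * Complex.normSq (complexCoord ((B p).coord 0) v / a) : ℝ) : ℂ) ⊗ₜ[ℝ]
      B p 2)

include hB in
-- For `Z = f F`, modulo the line and its conjugate, `[conj Z, Z]` equals `|f|² [conj F, F] = |f|² ·
-- 2i Im (conj a * b) · c Y₂`. Derivatives of `f` drop out, so only the value `Z p` matters, and the
-- factor `1 / 2i` makes the coefficient real.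
theorem isLeviForm_frameLine {a b : ℂ} {c : ℝ} (h : (conj a * b).im ≠ 0)
    (hc : ∀ p, VectorField.mlieBracket I (fun q ↦ B q 0) (fun q ↦ B q 1) p = c • B p 2) :
    IsLeviForm I (frameLine B a b) (frameLeviForm B a b c) := by
  intro U Z hZ p hp
  have ha := im_ne_zero_left h
  have hdZ := mdifferentiableAt_frameCoeff hB a (hZ.smooth.cMDifferentiableAt hZ.isOpen hp)
  have hF := cMDifferentiableAt_frameField hB a b p
  have hF' := cMDifferentiableAt_frameField hB (conj a) (conj b) p
  obtain ⟨k, l, hkl⟩ := exists_cLieBracket_smul_smul (f := fun q ↦ conj (frameCoeff B a Z q))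
    hF' hF hdZ.1 hdZ.2.neg hdZ.1 hdZ.2
  have hconj (q : M) (hq : q ∈ U) : complexConj (Z q) =
      conj (frameCoeff B a Z q) • frameField B (conj a) (conj b) q := by
    rw [← complexConj_frameField, ← complexConj_smul,
      frameCoeff_smul_frameField B ha (hZ.mem q hq)]
  rw [cLieBracket_congr hZ.isOpen hp hconj
      (fun q hq ↦ (frameCoeff_smul_frameField B ha (hZ.mem q hq)).symm), hkl,
      cLieBracket_frameField hB, hc, frameLeviForm, Submodule.Quotient.eq]
  have hmem : k • frameField B (conj a) (conj b) p + l • frameField B a b p ∈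
      frameLine B a b p ⊔ conjSubmodule (frameLine B a b p) := by
    rw [conjSubmodule_frameLine, add_comm]
    exact Submodule.add_mem_sup (Submodule.smul_mem _ _ (frameField_mem B _ _ p))
      (Submodule.smul_mem _ _ (frameField_mem B _ _ p))
  have hval : (((conj a * b).im * c * Complex.normSq (frameCoeff B a Z p) : ℝ) : ℂ) ⊗ₜ[ℝ] B p 2 =
      (1 / (2 * Complex.I)) • (conj (frameCoeff B a Z p) * frameCoeff B a Z p) •
        ((conj a * b - conj b * a) ⊗ₜ[ℝ] (c • B p 2)) := by
    rw [TensorProduct.tmul_smul, TensorProduct.smul_tmul', TensorProduct.smul_tmul',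
      TensorProduct.smul_tmul']
    congr 1
    have him : conj a * b - conj b * a = 2 * ((conj a * b).im : ℂ) * Complex.I := by
      have := Complex.sub_conj (conj a * b)
      rw [map_mul, Complex.conj_conj, mul_comm a] at this
      rw [this]
      push_cast
      ring
    rw [him, ← Complex.normSq_eq_conj_mul_self]
    simp only [Complex.real_smul, smul_eq_mul, Complex.ofReal_mul]
    field_simp
  have hdiff : (((conj a * b).im * c * Complex.normSq (frameCoeff B a Z p) : ℝ) : ℂ) ⊗ₜ[ℝ] B p 2 -
      (1 / (2 * Complex.I)) • ((conj (frameCoeff B a Z p) * frameCoeff B a Z p) •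
        ((conj a * b - conj b * a) ⊗ₜ[ℝ] (c • B p 2)) + k • frameField B (conj a) (conj b) p +
          l • frameField B a b p) =
      (-(1 / (2 * Complex.I))) •
        (k • frameField B (conj a) (conj b) p + l • frameField B a b p) := by
    rw [hval]
    module
  exact hdiff ▸ Submodule.smul_mem _ (-(1 / (2 * Complex.I))) hmem

include hB in
theorem isStronglyPseudoconvex_frameLine {a b : ℂ} {c : ℝ} (h : (conj a * b).im ≠ 0)
    (hc0 : c ≠ 0)
    (hc : ∀ p, VectorField.mlieBracket I (fun q ↦ B q 0) (fun q ↦ B q 1) p = c • B p 2) :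
    IsStronglyPseudoconvex I (frameLine B a b) := by
  refine ⟨isHypersurfaceType_frameLine h, _, isLeviForm_frameLine hB h hc, fun p ↦ ?_⟩
  set s : ℝ := (conj a * b).im * c with hs
  have hs0 : s ≠ 0 := mul_ne_zero h hc0
  -- The covector is the third coordinate scaled by `s`, the coefficient of the Levi form; the
  -- values become `s² |k|²`, positive whatever the sign of `s`.
  refine ⟨(s : ℂ) • Submodule.liftQ _ (complexCoord ((B p).coord 2))
    (frameLine_sup_conj B h p).le, fun X ↦ ?_, fun v hv ↦ ?_⟩
  · rw [LinearMap.smul_apply, Submodule.liftQ_apply, complexCoord_tmul]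
    simp
  · obtain ⟨k, hk⟩ := Submodule.mem_span_singleton.1 v.2
    have ha := im_ne_zero_left h
    have hk' : complexCoord ((B p).coord 0) v / a = k := by
      rw [← hk, map_smul, complexCoord_frameField_zero, smul_eq_mul, mul_div_cancel_right₀ _ ha]
    have hk0 : k ≠ 0 := by
      rintro rfl
      apply hv
      ext1
      rw [← hk, zero_smul]
      rfl
    refine ⟨s ^ 2 * Complex.normSq k, by positivity [Complex.normSq_pos.2 hk0], ?_⟩
    rw [LinearMap.smul_apply, frameLeviForm, Submodule.liftQ_apply, complexCoord_tmul, hk', ← hs]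
    simp
    ring

end FrameCR

/-! ### Related vector fields and velocity fields -/

section Related

variable {E : Type*} [NormedAddCommGroup E] [NormedSpace ℝ E]
  {H : Type*} [TopologicalSpace H] {I : ModelWithCorners ℝ E H}
  {M : Type*} [TopologicalSpace M] [ChartedSpace H M] [IsManifold I ∞ M]
  {F : Type*} [NormedAddCommGroup F] [NormedSpace ℝ F]

open VectorField Topology

/-- If vector fields `V`, `W` on a manifold are related to vector fields `V'`, `W'` on a vector
space by a map `f`, then so are their Lie brackets. -/
theorem mvfderiv_mlieBracket [CompleteSpace E] [I.Boundaryless] {f : M → F}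
    (hf : ContMDiff I 𝓘(ℝ, F) ∞ f) {V W : ∀ q : M, TangentSpace I q} {V' W' : F → F} {x : M}
    (hV : MDifferentiableAt I I.tangent (fun q ↦ (⟨q, V q⟩ : TangentBundle I M)) x)
    (hW : MDifferentiableAt I I.tangent (fun q ↦ (⟨q, W q⟩ : TangentBundle I M)) x)
    (hV' : DifferentiableAt ℝ V' (f x)) (hW' : DifferentiableAt ℝ W' (f x))
    (hVV' : ∀ q, mvfderiv I f q (V q) = V' (f q)) (hWW' : ∀ q, mvfderiv I f q (W q) = W' (f q)) :
    mvfderiv I f x (mlieBracket I V W x) = lieBracket ℝ V' W' (f x) := by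
  set φ := extChartAt I x with hφ
  -- The map and both fields are read in the chart at `x`, which reduces the claim to vector spaces.
  set g : E → F := f ∘ φ.symm with hg
  set V₀ : E → E := mpullbackWithin 𝓘(ℝ, E) I φ.symm V (Set.range I) with hV₀
  set W₀ : E → E := mpullbackWithin 𝓘(ℝ, E) I φ.symm W (Set.range I) with hW₀
  have hdV : DifferentiableAt ℝ V₀ (φ x) := by
    refine (hV.mdifferentiableWithinAt
      (s := Set.univ)).differentiableWithinAt_mpullbackWithin_vectorField.differentiableAt ?_
    simp [I.range_eq_univ]
  have hdW : DifferentiableAt ℝ W₀ (φ x) := by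
    refine (hW.mdifferentiableWithinAt
      (s := Set.univ)).differentiableWithinAt_mpullbackWithin_vectorField.differentiableAt ?_
    simp [I.range_eq_univ]
  have hxt : φ x ∈ φ.target := mem_extChartAt_target x
  have hopen : φ.target ∈ 𝓝 (φ x) := extChartAt_target_mem_nhds x
  have hgx : g (φ x) = f x := by simp [hg, hφ]
  have hgs : ContDiffAt ℝ ∞ g (φ x) := by
    rw [← contMDiffAt_iff_contDiffAt]
    exact hf.contMDiffAt.comp _ ((contMDiffOn_extChartAt_symm x).contMDiffAt hopen)
  have hrel (U : ∀ q : M, TangentSpace I q) (U' : F → F)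
      (hU : ∀ q, mvfderiv I f q (U q) = U' (f q)) :
      (fun y ↦ fderiv ℝ g y (mpullbackWithin 𝓘(ℝ, E) I φ.symm U (Set.range I) y)) =ᶠ[𝓝 (φ x)]
        U' ∘ g := by
    filter_upwards [(isOpen_extChartAt_target x).mem_nhds hxt] with y hy
    have hinv := isInvertible_mfderivWithin_extChartAt_symm (I := I) hy
    have hs : MDifferentiableAt 𝓘(ℝ, E) I φ.symm y :=
      ((contMDiffOn_extChartAt_symm (n := ∞) x).contMDiffAt
        ((isOpen_extChartAt_target x).mem_nhds hy)).mdifferentiableAt (by simp)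
    have hc := mfderiv_comp_apply y (hf.mdifferentiable (by simp) (φ.symm y)) hs
      (mpullbackWithin 𝓘(ℝ, E) I φ.symm U (Set.range I) y)
    rw [mfderiv_eq_fderiv] at hc
    refine hc.trans ?_
    have hsU : mfderiv 𝓘(ℝ, E) I φ.symm y
        (mpullbackWithin 𝓘(ℝ, E) I φ.symm U (Set.range I) y) = U (φ.symm y) := by
      rw [← mfderivWithin_univ, ← I.range_eq_univ]
      exact hinv.self_apply_inverse _
    rw [hsU]
    exact hU _
  have h1 := hrel V V' hVV'
  have h2 := hrel W W' hWW'
  have hdg : DifferentiableAt ℝ g (φ x) := hgs.differentiableAt (by simp)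
  have hmin : minSmoothness ℝ 2 ≤ ∞ := by
    rw [minSmoothness_of_isRCLikeNormedField]
    exact WithTop.coe_le_coe.2 le_top
  -- By symmetry of the second derivative, `dg [V₀, W₀]` involves only the derivatives of the
  -- functions `dg (V₀)` and `dg (W₀)`, which near `φ x` are `V' ∘ g` and `W' ∘ g`.
  have key := fderiv_apply_lieBracket hgs hmin hdW hdV
  rw [h1.fderiv_eq, h2.fderiv_eq, fderiv_comp _ (hgx ▸ hW') hdg, fderiv_comp _ (hgx ▸ hV') hdg]
    at key
  have e1 : mlieBracket I V W x = lieBracket ℝ V₀ W₀ (φ x) := by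
    -- Tangent vectors at `x` are represented in the preferred chart at `x`, whose derivative there
    -- is the identity.
    have hid (v : E) : (mfderiv I 𝓘(ℝ, E) (extChartAt I x) x).inverse v = v := by
      rw [mfderiv_extChartAt_self]
      exact DFunLike.congr_fun (ContinuousLinearMap.inverse_id (R := ℝ) (M := E)) v
    rw [← mlieBracketWithin_univ, mlieBracketWithin_apply]
    refine (hid _).trans ?_
    rw [Set.preimage_univ, Set.univ_inter]
    conv_rhs => rw [← lieBracketWithin_univ, ← I.range_eq_univ]
  have e2 : mvfderiv I f x = fderiv ℝ g (φ x) := by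
    rw [(hf.mdifferentiable (by simp) x).mvfderiv, I.range_eq_univ, fderivWithin_univ]
    rfl
  have e3 : fderiv ℝ g (φ x) (V₀ (φ x)) = V' (f x) := h1.self_of_nhds.trans (by simp [hgx])
  have e4 : fderiv ℝ g (φ x) (W₀ (φ x)) = W' (f x) := h2.self_of_nhds.trans (by simp [hgx])
  rw [ContinuousLinearMap.comp_apply, ContinuousLinearMap.comp_apply, e3, e4, hgx] at key
  rw [e2, e1]
  exact key

end Related

section Velocity

variable {E : Type*} [NormedAddCommGroup E] [NormedSpace ℝ E]
  {H : Type*} [TopologicalSpace H] {I : ModelWithCorners ℝ E H}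
  {M : Type*} [TopologicalSpace M] [ChartedSpace H M] [IsManifold I ∞ M]

/-- All tangent spaces are the model space `E` by definition, so a vector can be kept while its base
point is rewritten. -/
theorem tangentBundle_mk_eq {E : Type*} [NormedAddCommGroup E] [NormedSpace ℝ E]
    {H : Type*} [TopologicalSpace H] {I : ModelWithCorners ℝ E H}
    {M : Type*} [TopologicalSpace M] [ChartedSpace H M] {x y : M} (h : x = y) (v : E) :
    (⟨x, v⟩ : TangentBundle I M) = ⟨y, v⟩ := by
  rw [h]

/-- The initial velocity field of a smooth family of curves is smooth. -/
theorem contMDiff_velocity {Φ : ℝ × M → M} (hΦ : ContMDiff (𝓘(ℝ, ℝ).prod I) I ∞ Φ) 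
    (h0 : ∀ x, Φ (0, x) = x) :
    ContMDiff I I.tangent ∞ (fun x ↦
      (⟨x, mfderiv 𝓘(ℝ, ℝ) I (fun t ↦ Φ (t, x)) 0 (1 : ℝ)⟩ : TangentBundle I M)) := by
  have h1 : ContMDiff I 𝓘(ℝ, ℝ).tangent ∞ (fun _ : M ↦ (⟨0, (1 : ℝ)⟩ : TangentBundle 𝓘(ℝ, ℝ) ℝ)) :=
    contMDiff_const
  have h2 : ContMDiff I I.tangent ∞ (fun x : M ↦ (⟨x, (0 : E)⟩ : TangentBundle I M)) :=
    Bundle.contMDiff_zeroSection ℝ (TangentSpace I)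
  -- The velocity field is the tangent map of `Φ` applied to the smooth section `x ↦ ((0, 1), (x,
  -- 0))`.
  have h3 := (hΦ.contMDiff_tangentMap (m := ∞) le_rfl).comp
    (contMDiff_equivTangentBundleProd_symm.comp (h1.prodMk h2))
  convert h3 using 1
  ext1 x
  have hc : mfderiv 𝓘(ℝ, ℝ) I (fun t ↦ Φ (t, x)) 0 (1 : ℝ) =
      mfderiv (𝓘(ℝ, ℝ).prod I) I Φ (0, x) ((1 : ℝ), (0 : E)) := by
    have h := mfderiv_comp_apply (I := 𝓘(ℝ, ℝ)) (f := fun t : ℝ ↦ (t, x)) (0 : ℝ)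
      (hΦ.mdifferentiable (by simp) (0, x))
      (mdifferentiableAt_id.prodMk mdifferentiableAt_const) (1 : ℝ)
    exact h.trans (congrArg (mfderiv (𝓘(ℝ, ℝ).prod I) I Φ (0, x))
      (DFunLike.congr_fun (mfderiv_prod_left (I := 𝓘(ℝ, ℝ)) (I' := I)) (1 : ℝ)))
  refine (tangentBundle_mk_eq (h0 x).symm _).trans ?_
  rw [hc]
  rfl

end Velocity

/-! ### The left-invariant frame of the sphere -/

/-- Multiplication by the quaternion `j` from the right. -/
def quaternionJ : C2 →ₗ[ℝ] C2 where
  toFun z := !₂[-conj (z 1), conj (z 0)]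
  map_add' z w := by
    ext i
    fin_cases i <;> simp [add_comm]
  map_smul' c z := by
    ext i
    fin_cases i <;> simp

/-- The real linear vector fields on `ℂ²` that restrict to a left-invariant frame of the
three-sphere. -/
def frameGenerator : Fin 3 → C2 →L[ℝ] C2 :=
  ![quaternionJ.toContinuousLinearMap, Complex.I • quaternionJ.toContinuousLinearMap,
    Complex.I • ContinuousLinearMap.id ℝ C2]

theorem frameGenerator_zero (z : C2) : frameGenerator 0 z = !₂[-conj (z 1), conj (z 0)] := rfl

theorem frameGenerator_one (z : C2) :
    frameGenerator 1 z = Complex.I • !₂[-conj (z 1), conj (z 0)] := rfl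

theorem frameGenerator_two (z : C2) : frameGenerator 2 z = Complex.I • z := rfl

theorem norm_eq_one_iff_normSq (z : C2) :
    ‖z‖ = 1 ↔ Complex.normSq (z 0) + Complex.normSq (z 1) = 1 := by
  rw [EuclideanSpace.norm_eq, Real.sqrt_eq_one, Fin.sum_univ_two, Complex.normSq_eq_norm_sq,
    Complex.normSq_eq_norm_sq]

/-- Each generator sends a unit vector `z` to a unit vector that is orthogonal to `z` for the real
inner product, so the curve is a great circle. -/
theorem norm_cos_add_sin_frameGenerator (j : Fin 3) (t : ℝ) (z : S3) :
    ‖Real.cos t • z.1 + Real.sin t • frameGenerator j z.1‖ = 1 := by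
  have hz := (norm_eq_one_iff_normSq z.1).1 (by simp)
  rw [norm_eq_one_iff_normSq]
  have hcs := Real.cos_sq_add_sin_sq t
  simp only [Complex.normSq_apply] at hz ⊢
  generalize Real.cos t = c at *
  generalize Real.sin t = s at *
  fin_cases j
  · simp [frameGenerator_zero]
    linear_combination (c ^ 2 + s ^ 2) * hz + hcs
  · simp [frameGenerator_one]
    linear_combination (c ^ 2 + s ^ 2) * hz + hcs
  · simp [frameGenerator_two]
    linear_combination (c ^ 2 + s ^ 2) * hz + hcs

/-- The flow of the field `frameGenerator j` on the sphere. -/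
def sphereFlow (j : Fin 3) : ℝ × S3 → S3 :=
  Set.codRestrict (fun p ↦ Real.cos p.1 • p.2.1 + Real.sin p.1 • frameGenerator j p.2.1)
    (Metric.sphere (0 : C2) 1) fun p ↦ by
      rw [mem_sphere_zero_iff_norm]
      exact norm_cos_add_sin_frameGenerator j p.1 p.2

theorem sphereFlow_coe (j : Fin 3) (p : ℝ × S3) :
    (sphereFlow j p).1 = Real.cos p.1 • p.2.1 + Real.sin p.1 • frameGenerator j p.2.1 := rfl

theorem sphereFlow_zero (j : Fin 3) (z : S3) : sphereFlow j (0, z) = z := by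
  ext1
  simp [sphereFlow_coe]

theorem contMDiff_sphereFlow (j : Fin 3) :
    ContMDiff (𝓘(ℝ, ℝ).prod (𝓡 3)) (𝓡 3) ∞ (sphereFlow j) := by
  apply ContMDiff.codRestrict_sphere
  have h1 : ContMDiff (𝓘(ℝ, ℝ).prod (𝓡 3)) 𝓘(ℝ, C2) ∞ fun p : ℝ × S3 ↦ p.2.1 :=
    contMDiff_coe_sphere.comp contMDiff_snd
  have h2 : ContMDiff (𝓘(ℝ, ℝ).prod (𝓡 3)) 𝓘(ℝ, C2) ∞
      fun p : ℝ × S3 ↦ frameGenerator j p.2.1 :=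
    (frameGenerator j).contMDiff.comp h1
  have hc : ContMDiff (𝓘(ℝ, ℝ).prod (𝓡 3)) 𝓘(ℝ, ℝ) ∞ fun p : ℝ × S3 ↦ Real.cos p.1 :=
    Real.contDiff_cos.contMDiff.comp contMDiff_fst
  have hs : ContMDiff (𝓘(ℝ, ℝ).prod (𝓡 3)) 𝓘(ℝ, ℝ) ∞ fun p : ℝ × S3 ↦ Real.sin p.1 :=
    Real.contDiff_sin.contMDiff.comp contMDiff_fst
  exact (hc.smul h1).add (hs.smul h2)

theorem contMDiff_sphere_smul (g : SU2) : ContMDiff (𝓡 3) (𝓡 3) ∞ fun z : S3 ↦ g • z := by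
  have hmem (z : S3) : WithLp.toLp 2 (Matrix.mulVec g.1 (WithLp.ofLp z.1)) ∈
      Metric.sphere (0 : C2) 1 := by
    rw [← sphere_smul_coe]
    exact (g • z).2
  have h : ContMDiff (𝓡 3) (𝓡 3) ∞ (Set.codRestrict (fun z : S3 ↦
      WithLp.toLp 2 (Matrix.mulVec g.1 (WithLp.ofLp z.1))) (Metric.sphere (0 : C2) 1) hmem) := by
    apply ContMDiff.codRestrict_sphere
    have hl : ContDiff ℝ ∞ fun z : C2 ↦
        (WithLp.toLp 2 (Matrix.mulVec g.1 (WithLp.ofLp z)) : C2) := by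
      have hlin := (((Matrix.toEuclideanLin g.1).restrictScalars ℝ).toContinuousLinearMap).contDiff
        (n := ∞)
      exact hlin
    exact hl.contMDiff.comp contMDiff_coe_sphere
  convert h using 1
  ext1 z
  ext1
  exact sphere_smul_coe g z

/-- Left and right multiplications commute: `J z` is the second column of the matrix of `z`, and
multiplication by `i` commutes with complex matrices. This is what makes the frame descend. -/
theorem sphereFlow_smul (j : Fin 3) (g : SU2) (t : ℝ) (z : S3) :
    sphereFlow j (t, g • z) = g • sphereFlow j (t, z) := by
  -- The antilinear map `J` does not commute with every complex matrix, so the explicit form of the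
  -- entries of `g` is needed.
  obtain ⟨w, rfl⟩ := sphereEquivSU2.surjective g
  ext1
  rw [sphere_smul_coe, sphereFlow_coe, sphereFlow_coe, sphere_smul_coe]
  ext i
  fin_cases j <;> fin_cases i <;>
  · simp [frameGenerator_zero, frameGenerator_one, frameGenerator_two, sphereEquivSU2,
      Matrix.mulVec, dotProduct, Fin.sum_univ_two]
    ring

/-- The left-invariant vector field on the sphere that is the restriction of
`frameGenerator j`. -/
def sphereField (j : Fin 3) (z : S3) : TangentSpace (𝓡 3) z :=
  mfderiv 𝓘(ℝ, ℝ) (𝓡 3) (fun t ↦ sphereFlow j (t, z)) 0 (1 : ℝ)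

theorem contMDiff_sphereField (j : Fin 3) :
    ContMDiff (𝓡 3) (𝓡 3).tangent ∞
      fun z ↦ (⟨z, sphereField j z⟩ : TangentBundle (𝓡 3) S3) :=
  contMDiff_velocity (contMDiff_sphereFlow j) (sphereFlow_zero j)

theorem mdifferentiable_sphereFlow_left (j : Fin 3) (z : S3) :
    MDifferentiableAt 𝓘(ℝ, ℝ) (𝓡 3) (fun t ↦ sphereFlow j (t, z)) 0 :=
  ((contMDiff_sphereFlow j).mdifferentiable (by simp) (0, z)).comp (0 : ℝ)
    (mdifferentiableAt_id.prodMk mdifferentiableAt_const)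

theorem mvfderiv_coe_sphereField (j : Fin 3) (z : S3) :
    mvfderiv (𝓡 3) (Subtype.val : S3 → C2) z (sphereField j z) = frameGenerator j z.1 := by
  have h := mfderiv_comp_apply_of_eq (0 : ℝ)
    (contMDiff_coe_sphere.mdifferentiable (n := 1) one_ne_zero z)
    (mdifferentiable_sphereFlow_left j z) (sphereFlow_zero j z) (1 : ℝ)
  rw [mfderiv_eq_fderiv] at h
  refine h.symm.trans ?_
  have hd : HasDerivAt (fun t : ℝ ↦ Real.cos t • z.1 + Real.sin t • frameGenerator j z.1)
      (frameGenerator j z.1) 0 := by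
    exact (((Real.hasDerivAt_cos 0).smul_const z.1).add
      ((Real.hasDerivAt_sin 0).smul_const (frameGenerator j z.1))).congr_deriv (by simp)
  have he : (Subtype.val ∘ fun t ↦ sphereFlow j (t, z)) =
      fun t : ℝ ↦ Real.cos t • z.1 + Real.sin t • frameGenerator j z.1 := rfl
  rw [he, hd.hasFDerivAt.fderiv]
  exact one_smul ℝ (frameGenerator j z.1)

/-- The differential of the inclusion is injective, so the bracket can be computed in `ℂ²`. For
linear fields `A`, `B` it is `B A - A B`; with `A = J`, `B = i J`, `J² = -1` and `J i = -i J` this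
gives `-2i`. -/
theorem mlieBracket_sphereField (z : S3) :
    VectorField.mlieBracket (𝓡 3) (sphereField 0) (sphereField 1) z =
      (-2 : ℝ) • sphereField 2 z := by
  apply injective_mvfderiv_subtypeVal_sphere z
  rw [mvfderiv_mlieBracket (V' := frameGenerator 0) (W' := frameGenerator 1) contMDiff_coe_sphere
    ((contMDiff_sphereField 0).mdifferentiable (by simp) z)
    ((contMDiff_sphereField 1).mdifferentiable (by simp) z)
    (frameGenerator 0).differentiableAt (frameGenerator 1).differentiableAt
    (mvfderiv_coe_sphereField 0) (mvfderiv_coe_sphereField 1), map_smul,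
    mvfderiv_coe_sphereField]
  simp only [VectorField.lieBracket, ContinuousLinearMap.fderiv]
  ext i
  fin_cases i <;>
  · simp [frameGenerator_zero, frameGenerator_one, frameGenerator_two]
    ring

theorem linearIndependent_frameGenerator {z : C2} (hz : ‖z‖ = 1) :
    LinearIndependent ℝ fun j ↦ frameGenerator j z := by
  rw [Fintype.linearIndependent_iff]
  intro c hc
  rw [Fin.sum_univ_three, frameGenerator_zero, frameGenerator_one, frameGenerator_two] at hc
  have h0 := congrArg (fun w : C2 ↦ w 0) hc
  have h1 := congrArg (fun w : C2 ↦ w 1) hc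
  simp at h0 h1
  have hz' : z 0 * conj (z 0) + z 1 * conj (z 1) = 1 := by
    rw [Complex.mul_conj, Complex.mul_conj, ← Complex.ofReal_add, (norm_eq_one_iff_normSq z).1 hz,
      Complex.ofReal_one]
  -- The vectors `z` and `J z` are Hermitian orthonormal; pairing the relation with `z` isolates `i
  -- c₂`, and pairing with `J z` isolates `c₀ + i c₁`.
  have e2 : (c 2 : ℂ) * Complex.I = 0 := by
    linear_combination conj (z 0) * h0 + conj (z 1) * h1 - (c 2 : ℂ) * Complex.I * hz'
  have e01 : (c 0 : ℂ) + c 1 * Complex.I = 0 := by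
    linear_combination -z 1 * h0 + z 0 * h1 - ((c 0 : ℂ) + c 1 * Complex.I) * hz'
  have r2 : c 2 = 0 := by simpa using e2
  have r0 := congrArg Complex.re e01
  have r1 := congrArg Complex.im e01
  simp at r0 r1
  intro j
  fin_cases j <;> assumption

theorem linearIndependent_sphereField (z : S3) :
    LinearIndependent ℝ fun j ↦ sphereField j z := by
  apply LinearIndependent.of_comp (mvfderiv (𝓡 3) (Subtype.val : S3 → C2) z).toLinearMap
  have h : (mvfderiv (𝓡 3) (Subtype.val : S3 → C2) z).toLinearMap ∘ (fun j ↦ sphereField j z) =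
      fun j ↦ frameGenerator j z.1 := funext fun j ↦ mvfderiv_coe_sphereField j z
  rw [h]
  exact linearIndependent_frameGenerator (by simp)

/-- The left-invariant frame of the sphere. -/
def sphereBasis (z : S3) : Module.Basis (Fin 3) ℝ (TangentSpace (𝓡 3) z) :=
  basisOfLinearIndependentOfCardEqFinrank (linearIndependent_sphereField z)
    (by rw [Fintype.card_fin]; exact (finrank_euclideanSpace_fin (𝕜 := ℝ) (n := 3)).symm)

theorem sphereBasis_apply (z : S3) (j : Fin 3) : sphereBasis z j = sphereField j z := by
  simp [sphereBasis]

/-! ### The standard and the Rossi bundles in terms of the left-invariant frame -/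

theorem sphereInclDeriv_injective (z : S3) : Function.Injective (sphereInclDeriv z) :=
  Module.Flat.lTensor_preserves_injective_linearMap _ (injective_mvfderiv_subtypeVal_sphere z)

theorem sphereInclDeriv_frameField (a b : ℂ) (z : S3) :
    sphereInclDeriv z (frameField sphereBasis a b z) =
      a ⊗ₜ[ℝ] frameGenerator 0 z.1 + b ⊗ₜ[ℝ] frameGenerator 1 z.1 := by
  rw [frameField, sphereBasis_apply, sphereBasis_apply, map_add, ← mvfderiv_coe_sphereField,
    ← mvfderiv_coe_sphereField]
  rfl

/-- Since `Y₁ = i Y₀`, the right side is the `(1,0)`-part of the real field `Y₀`, and `crFieldBar`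
is its `(0,1)`-part. -/
theorem crField_eq (z : C2) :
    crField z = (1 / 2 : ℂ) ⊗ₜ[ℝ] frameGenerator 0 z +
      (-Complex.I / 2) ⊗ₜ[ℝ] frameGenerator 1 z := by
  apply complex_tensor_ext <;> ext i <;> fin_cases i <;> apply Complex.ext <;>
    simp [crField, dz, complexRe_smul, complexIm_smul, frameGenerator_zero, frameGenerator_one] <;> ring

theorem crFieldBar_eq (z : C2) :
    crFieldBar z = (1 / 2 : ℂ) ⊗ₜ[ℝ] frameGenerator 0 z +
      (Complex.I / 2) ⊗ₜ[ℝ] frameGenerator 1 z := by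
  apply complex_tensor_ext <;> ext i <;> fin_cases i <;> apply Complex.ext <;>
    simp [crFieldBar, dzbar, complexRe_smul, complexIm_smul, frameGenerator_zero, frameGenerator_one] <;> ring

theorem rossiField_eq (t : ℂ) (z : C2) :
    rossiField t z = ((1 + conj t) / 2) ⊗ₜ[ℝ] frameGenerator 0 z +
      (-Complex.I * (1 - conj t) / 2) ⊗ₜ[ℝ] frameGenerator 1 z := by
  have e0 : (1 + conj t) / 2 = 1 / 2 + conj t * (1 / 2) := by ring
  have e1 : -Complex.I * (1 - conj t) / 2 = -Complex.I / 2 + conj t * (Complex.I / 2) := by ring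
  rw [rossiField, crField_eq, crFieldBar_eq, e0, e1]
  simp only [smul_add, TensorProduct.smul_tmul', TensorProduct.add_tmul, smul_eq_mul]
  abel

/-- The field `ℒ_t` is the image of a tangent field of the sphere under an injective differential,
so pulling back its span gives the span of that field. -/
theorem rossiBundle_eq_frameLine (t : ℂ) (z : S3) :
    rossiBundle t z =
      frameLine sphereBasis ((1 + conj t) / 2) (-Complex.I * (1 - conj t) / 2) z := by
  rw [rossiBundle, rossiField_eq, ← sphereInclDeriv_frameField, ← Set.image_singleton,
    ← Submodule.map_span, Submodule.comap_map_eq_of_injective (sphereInclDeriv_injective z),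
    frameLine]

theorem standardBundle_eq_rossiBundle : standardBundle = rossiBundle 0 := by
  ext1 z
  simp [standardBundle, rossiBundle, rossiField]

/-- This is where `|t| < 1` enters: the value vanishes exactly for `|t| = 1`, when `ℒ_t` and its
conjugate become proportional. -/
theorem im_conj_mul_rossi (t : ℂ) :
    (conj ((1 + conj t) / 2) * (-Complex.I * (1 - conj t) / 2)).im = -(1 - ‖t‖ ^ 2) / 4 := by
  have h : conj ((1 + conj t) / 2) * (-Complex.I * (1 - conj t) / 2) =
      ((1 / 4 : ℝ) : ℂ) * ((1 + t) * (-Complex.I * (1 - conj t))) := by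
    simp only [map_div₀, map_add, map_one, Complex.conj_conj, Complex.conj_ofNat]
    push_cast
    ring
  rw [← Complex.normSq_eq_norm_sq, Complex.normSq_apply, h, Complex.im_ofReal_mul]
  simp
  ring

/-! ### The frame of the quotient -/

section Quotient

variable (Γ : Subgroup SU2)

theorem sphereProj_surjective : Function.Surjective (sphereProj Γ) := Quotient.mk_surjective

variable [Finite Γ]

theorem isManifold_sphereQuotient : IsManifold (𝓡 3) ∞ (SphereQuotient Γ) :=
  isManifold_quotient fun g : Γ ↦ contMDiff_sphere_smul g

theorem isLocalDiffeomorph_sphereProj : IsLocalDiffeomorph (𝓡 3) (𝓡 3) ∞ (sphereProj Γ) :=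
  isLocalDiffeomorph_quotientMk fun g : Γ ↦ contMDiff_sphere_smul g

/-- The velocity in the quotient of the projected flow line through a point of the sphere. -/
def projVelocity (j : Fin 3) (z : S3) : EuclideanSpace ℝ (Fin 3) :=
  mfderiv 𝓘(ℝ, ℝ) (𝓡 3) (fun t ↦ sphereProj Γ (sphereFlow j (t, z))) 0 (1 : ℝ)

/-- The flow commutes with the action, so the flow lines through `z` and `g • z` have the same
projection. -/
theorem projVelocity_smul (j : Fin 3) (g : Γ) (z : S3) :
    projVelocity Γ j (g • z) = projVelocity Γ j z := by
  have h : (fun t ↦ sphereProj Γ (sphereFlow j (t, g • z))) =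
      fun t ↦ sphereProj Γ (sphereFlow j (t, z)) := by
    ext1 t
    exact (congrArg (sphereProj Γ) (sphereFlow_smul j g t z)).trans
      (Quotient.sound (MulAction.orbitRel_apply.2 ⟨g, rfl⟩))
  -- The velocities are compared in the fixed model space, which avoids transport between tangent
  -- spaces.
  exact congrArg (fun f : ℝ → SphereQuotient Γ ↦
    (mfderiv 𝓘(ℝ, ℝ) (𝓡 3) f 0 (1 : ℝ) : EuclideanSpace ℝ (Fin 3))) h

theorem mfderiv_sphereProj_sphereField (j : Fin 3) (z : S3) :
    mfderiv (𝓡 3) (𝓡 3) (sphereProj Γ) z (sphereField j z) = projVelocity Γ j z :=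
  (mfderiv_comp_apply_of_eq (0 : ℝ)
    ((isLocalDiffeomorph_sphereProj Γ).mdifferentiable (by simp) z)
    (mdifferentiable_sphereFlow_left j z) (sphereFlow_zero j z) (1 : ℝ)).symm

/-- The vector field on the quotient induced by `sphereField j`. -/
def quotientField (j : Fin 3) (q : SphereQuotient Γ) : TangentSpace (𝓡 3) q :=
  projVelocity Γ j q.out

/-- The chosen representative `q.out` lies in the orbit of `z`, and the projected velocity is
constant on orbits. -/
theorem quotientField_sphereProj (j : Fin 3) (z : S3) :
    quotientField Γ j (sphereProj Γ z) =
      mfderiv (𝓡 3) (𝓡 3) (sphereProj Γ) z (sphereField j z) := by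
  rw [mfderiv_sphereProj_sphereField]
  obtain ⟨g, hg⟩ := MulAction.orbitRel_apply.1 (Quotient.mk_out (s := MulAction.orbitRel Γ S3) z)
  have : (sphereProj Γ z).out = g • z := hg.symm
  rw [quotientField, this, projVelocity_smul]

theorem mfderiv_sphereProj_isInvertible (z : S3) :
    (mfderiv (𝓡 3) (𝓡 3) (sphereProj Γ) z).IsInvertible :=
  have hn : (∞ : WithTop ℕ∞) ≠ 0 := by simp
  ⟨(isLocalDiffeomorph_sphereProj Γ).mfderivToContinuousLinearEquiv hn z,
    (isLocalDiffeomorph_sphereProj Γ).mfderivToContinuousLinearEquiv_coe hn z⟩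

theorem linearIndependent_quotientField (q : SphereQuotient Γ) :
    LinearIndependent ℝ fun j ↦ quotientField Γ j q := by
  obtain ⟨z, rfl⟩ := sphereProj_surjective Γ q
  simp only [quotientField_sphereProj]
  exact (linearIndependent_sphereField z).map' _
    (LinearMap.ker_eq_bot.2 (mfderiv_sphereProj_isInvertible Γ z).injective)

/-- The frame of the quotient induced by the left-invariant frame of the sphere. -/
def quotientBasis (q : SphereQuotient Γ) : Module.Basis (Fin 3) ℝ (TangentSpace (𝓡 3) q) :=
  basisOfLinearIndependentOfCardEqFinrank (linearIndependent_quotientField Γ q)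
    (by rw [Fintype.card_fin]; exact (finrank_euclideanSpace_fin (𝕜 := ℝ) (n := 3)).symm)

theorem quotientBasis_apply (q : SphereQuotient Γ) (j : Fin 3) :
    quotientBasis Γ q j = quotientField Γ j q := by
  simp [quotientBasis]

/-- Near each point the field is `dπ ∘ Y_j` composed with a smooth local inverse of `π`. -/
theorem contMDiff_quotientField [IsManifold (𝓡 3) ∞ (SphereQuotient Γ)] (j : Fin 3) :
    ContMDiff (𝓡 3) (𝓡 3).tangent ∞
      fun q ↦ (⟨q, quotientField Γ j q⟩ : TangentBundle (𝓡 3) (SphereQuotient Γ)) := by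
  intro q
  obtain ⟨z, rfl⟩ := sphereProj_surjective Γ q
  have hz := isLocalDiffeomorph_sphereProj Γ z
  have h1 := hz.localInverse_contMDiffAt
  have h2 := (contMDiff_sphereField j).contMDiffAt.comp (sphereProj Γ z) h1
  have h3 := ((isLocalDiffeomorph_sphereProj Γ).contMDiff.contMDiff_tangentMap
    (m := ∞) le_rfl).contMDiffAt.comp (sphereProj Γ z) h2
  refine h3.congr_of_eventuallyEq ?_
  filter_upwards [hz.localInverse_open_source.mem_nhds hz.localInverse_mem_source] with q hq
  have e : sphereProj Γ (hz.localInverse q) = q := hz.localInverse_right_inv hq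
  refine (tangentBundle_mk_eq e.symm _).trans ?_
  have e' := quotientField_sphereProj Γ j (hz.localInverse q)
  rw [e] at e'
  rw [e']
  rfl

theorem mpullback_quotientField (j : Fin 3) :
    VectorField.mpullback (𝓡 3) (𝓡 3) (sphereProj Γ) (quotientField Γ j) = sphereField j := by
  ext1 z
  rw [VectorField.mpullback_apply, quotientField_sphereProj]
  exact (mfderiv_sphereProj_isInvertible Γ z).inverse_apply_self _

/-- Pullback by the local diffeomorphism `π` respects brackets and returns the fields of the sphere,
so the relation found there is pushed forward. -/
theorem mlieBracket_quotientField [IsManifold (𝓡 3) ∞ (SphereQuotient Γ)]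
    (q : SphereQuotient Γ) :
    VectorField.mlieBracket (𝓡 3) (quotientField Γ 0) (quotientField Γ 1) q =
      (-2 : ℝ) • quotientField Γ 2 q := by
  obtain ⟨z, rfl⟩ := sphereProj_surjective Γ q
  have hmin : minSmoothness ℝ 2 ≤ ∞ := by
    rw [minSmoothness_of_isRCLikeNormedField]
    exact WithTop.coe_le_coe.2 le_top
  have : IsManifold (𝓡 3) (minSmoothness ℝ 2) (SphereQuotient Γ) := IsManifold.of_le hmin
  have : IsManifold (𝓡 3) (minSmoothness ℝ 2) S3 := IsManifold.of_le (n := ∞) hmin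
  have h := VectorField.mpullback_mlieBracket (f := sphereProj Γ)
    ((contMDiff_quotientField Γ 0).mdifferentiable (by simp) (sphereProj Γ z))
    ((contMDiff_quotientField Γ 1).mdifferentiable (by simp) (sphereProj Γ z))
    (isLocalDiffeomorph_sphereProj Γ).contMDiff.contMDiffAt hmin
  rw [mpullback_quotientField, mpullback_quotientField, mlieBracket_sphereField,
    VectorField.mpullback_apply] at h
  have h' := congrArg (mfderiv (𝓡 3) (𝓡 3) (sphereProj Γ) z) h
  rw [(mfderiv_sphereProj_isInvertible Γ z).self_apply_inverse, map_smul,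
    ← quotientField_sphereProj] at h'
  exact h'

theorem map_cmfderiv_frameLine (a b : ℂ) (z : S3) :
    (frameLine sphereBasis a b z).map (cmfderiv (𝓡 3) (sphereProj Γ) z) =
      frameLine (quotientBasis Γ) a b (sphereProj Γ z) := by
  rw [frameLine, Submodule.map_span, Set.image_singleton, frameLine, frameField, frameField,
    sphereBasis_apply, sphereBasis_apply, quotientBasis_apply, quotientBasis_apply,
    quotientField_sphereProj, quotientField_sphereProj, map_add]
  rfl

theorem exists_imageBundle_rossiBundle [IsManifold (𝓡 3) ∞ (SphereQuotient Γ)] (t : ℂ)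
    (ht : ‖t‖ < 1) :
    ∃ L : ∀ q : SphereQuotient Γ, Submodule ℂ (CTangentSpace (𝓡 3) q),
      IsImageBundle (𝓡 3) (sphereProj Γ) (rossiBundle t) L ∧
      IsCRBundle (𝓡 3) L 1 ∧ IsStronglyPseudoconvex (𝓡 3) L := by
  have him : (conj ((1 + conj t) / 2) * (-Complex.I * (1 - conj t) / 2)).im ≠ 0 := by
    rw [im_conj_mul_rossi]
    have : 0 ≤ ‖t‖ := norm_nonneg t
    have : 0 < 1 - ‖t‖ ^ 2 := by nlinarith
    exact (div_neg_of_neg_of_pos (by linarith) (by norm_num)).ne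
  have hB (i : Fin 3) : ContMDiff (𝓡 3) (𝓡 3).tangent ∞
      (fun q ↦ (⟨q, quotientBasis Γ q i⟩ : TangentBundle (𝓡 3) (SphereQuotient Γ))) := by
    simpa only [quotientBasis_apply] using contMDiff_quotientField Γ i
  -- The image bundle is the line with the same constant coefficients in the quotient frame, and `c
  -- = -2` is the structure constant of `[Y₀, Y₁]`.
  refine ⟨frameLine (quotientBasis Γ) _ _, fun z ↦ ?_, isCRBundle_frameLine hB him,
    isStronglyPseudoconvex_frameLine (c := -2) hB him (by norm_num) fun q ↦ ?_⟩
  · rw [rossiBundle_eq_frameLine, map_cmfderiv_frameLine]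
  · simp only [quotientBasis_apply]
    exact mlieBracket_quotientField Γ q

end Quotient

theorem mainTheorem7 (Γ : Subgroup SU2) [Finite Γ] :
    T2Space (SphereQuotient Γ) ∧ SecondCountableTopology (SphereQuotient Γ) ∧
    ∃ _ : IsManifold (𝓡 3) ∞ (SphereQuotient Γ),
      IsLocalDiffeomorph (𝓡 3) (𝓡 3) ∞ (sphereProj Γ) ∧
      (∃ L : ∀ q : SphereQuotient Γ, Submodule ℂ (CTangentSpace (𝓡 3) q),
        IsImageBundle (𝓡 3) (sphereProj Γ) standardBundle L ∧
        IsCRBundle (𝓡 3) L 1 ∧ IsStronglyPseudoconvex (𝓡 3) L) ∧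
      (∀ t : ℂ, ‖t‖ < 1 →
        ∃ L : ∀ q : SphereQuotient Γ, Submodule ℂ (CTangentSpace (𝓡 3) q),
          IsImageBundle (𝓡 3) (sphereProj Γ) (rossiBundle t) L ∧
          IsCRBundle (𝓡 3) L 1 ∧ IsStronglyPseudoconvex (𝓡 3) L) := by
  have hM := isManifold_sphereQuotient Γ
  refine ⟨t2Space_of_properlyDiscontinuousSMul_of_t2Space,
    ContinuousConstSMul.secondCountableTopology, hM, isLocalDiffeomorph_sphereProj Γ, ?_,
    exists_imageBundle_rossiBundle Γ⟩
  rw [standardBundle_eq_rossiBundle]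
  exact exists_imageBundle_rossiBundle Γ 0 (by simp)

end
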